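/- Let $0<h<1$, $Y_0=(0,h)$, $Y_1=(h,1)$, $Y=(0,1)$. Let $a_0,\rho_0:Y_0\to\mathbb R$ and $\rho_1:Y_1\to\mathbb R$ be measurable, bounded and uniformly positive, and let $\rho=\rho_0$ on $Y_0$, $\rho=\rho_1$ on $Y_1$. For $\theta\in[0,2\pi)$ let $V_\theta$ be the set of $u\in H^1(Y)$ with $u(1)=e^{i\theta}u(0)$ and $u'=0$ on $Y_1$, and let $A_\theta$ be the operator in the closure $\overline{V_\theta}$ of $V_\theta$ in the weighted space $L^2_\rho(Y)$ defined by: $A_\theta u=f$ if $u\in V_\theta$, $f\in\overline{V_\theta}$ and $$\int_{Y_0}a_0u'\overline{v'}=\int_Y\rho f\overline v\qquad\text{for all }v\in V_\theta .$$ Then $\bigcup_\theta\sigma(A_\theta)\subset[0,\infty)$ (here and below $\theta$ ranges over $[0,2\pi)$), and the following holds for every real $\lambda\ge0$. (1) There are real functions $v_1,v_2$ such that $v_j$ and $a_0v_j'$ are absolutely continuous on $[0,h]$, $-(a_0v_j')'=\lambda\rho_0v_j$ on $Y_0$, $v_1(0)=1$, $(a_0v_1')(0)=0$, $v_2(0)=0$,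 $(a_0v_2')(0)=1$; and for any such functions $$\lambda\in\bigcup_\theta\sigma(A_\theta)\iff\Big|v_1(h)+(a_0v_2')(h)-\lambda v_2(h)\int_{Y_1}\rho_1\Big|\le2 .$$ (2) Let $H^1_\theta(Y_0)$ be the set of $u\in H^1(Y_0)$ with $u(h)=e^{i\theta}u(0)$. For each $\theta$ there is a complete orthonormal sequence $(\Phi^{(n)}_\theta)_{n\in\mathbb N}$ in $L^2_{\rho_0}(Y_0)$, with $\Phi^{(n)}_\theta\in H^1_\theta(Y_0)$, and there are real $\mu_n(\theta)$ such that $$\int_{Y_0}a_0(\Phi^{(n)}_\theta)'\overline{v'}=\mu_n(\theta)\int_{Y_0}\rho_0\Phi^{(n)}_\theta\overline v\qquad\text{for all }v\in H^1_\theta(Y_0).$$ Given any choice of such sequences for all $\theta$, for every $\theta$ with $\lambda\ne\mu_n(\theta)$ for all $n$ one has $$\lambda\in\sigma(A_\theta)\iff\sum_{n}\frac{\lambda}{\mu_n(\theta)-\lambda}\big|\Phi^{(n)}_\theta(0)\big|^2=\Big(\int_{Y_1}\rho_1\Big)^{-1}.\qquad(*)$$ Moreover, if $\lambda\neq0$ and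 it is not the case that both $v_2(h)=0$ and $|v_1(h)|=1$, then $\lambda\in\bigcup_\theta\sigma(A_\theta)$ if and only if there is $\theta\in[0,2\pi)$ such that $\lambda\ne\mu_n(\theta)$ for all $n$ and the equality in $(*)$ holds. (Equality in $(*)$ includes convergence of the series.) -/

import Mathlib

open MeasureTheory Set

noncomputable section

namespace HighContrast

/-- `u` is absolutely continuous on `[a, b]` with (a.e. unique) derivative `g`: `u` is the
indefinite integral of the integrable function `g`. -/
def ACWith {E : Type*} [NormedAddCommGroup E] [NormedSpace ℝ E] (a b : ℝ) (u g : ℝ → E) : Prop :=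
  IntervalIntegrable g volume a b ∧ ∀ x ∈ Icc a b, u x = u a + ∫ t in a..x, g t

/-- `u ∈ H¹(a, b)` (represented by its continuous version on `[a, b]`) with `u' = g`. -/
def H1With (a b : ℝ) (u g : ℝ → ℂ) : Prop :=
  ACWith a b u g ∧ MemLp g 2 (volume.restrict (Ioo a b))

/-- `u ∈ H¹(0, ℓ)` with `u' = g` is `θ`-quasiperiodic over the interval: `u(ℓ) = e^{iθ} u(0)`.
For `ℓ = 1` this says that `u(y) = e^{iθy} v(y)` with `v ∈ H¹(0, 1)` periodic. -/
def H1QuasiPer (l θ : ℝ) (u g : ℝ → ℂ) : Prop :=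
  H1With 0 l u g ∧ u l = Complex.exp (Complex.I * θ) * u 0

/-- Measurable, bounded and uniformly positive almost everywhere on `s`; that is, `f > 0` and
`f, f⁻¹ ∈ L^∞(s)`. -/
def UnifPosBdd (f : ℝ → ℝ) (s : Set ℝ) : Prop :=
  AEMeasurable f (volume.restrict s) ∧
    ∃ c C : ℝ, 0 < c ∧ ∀ᵐ x ∂(volume.restrict s), c ≤ f x ∧ f x ≤ C

/-- The density on the unit cell: `ρ₀` on `Y₀ = (0, h)` and `ρ₁` on `Y₁ = (h, 1)`. -/
def cellDensity (h : ℝ) (ρ₀ ρ₁ : ℝ → ℝ) (y : ℝ) : ℝ := if y < h then ρ₀ y else ρ₁ y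

/-- The measure `ρ dy` on `Y = (0, 1)`. -/
def cellMeasure (h : ℝ) (ρ₀ ρ₁ : ℝ → ℝ) : Measure ℝ :=
  (volume.restrict (Ioo 0 1)).withDensity fun y => ENNReal.ofReal (cellDensity h ρ₀ ρ₁ y)

/-- The weighted space `L²_ρ(Y)`. -/
abbrev CellL2 (h : ℝ) (ρ₀ ρ₁ : ℝ → ℝ) : Type := Lp ℂ 2 (cellMeasure h ρ₀ ρ₁)

/-- `u ∈ V_θ` with `u' = g`: `u ∈ H¹_θ(Y)` and `u' = 0` on `Y₁`. -/
def InV (h θ : ℝ) (u g : ℝ → ℂ) : Prop :=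
  H1QuasiPer 1 θ u g ∧ ∀ᵐ y ∂(volume.restrict (Ioo h 1)), g y = 0

theorem ACWith.add {E : Type*} [NormedAddCommGroup E] [NormedSpace ℝ E] {a b : ℝ}
    {u g v k : ℝ → E} (hu : ACWith a b u g) (hv : ACWith a b v k) :
    ACWith a b (u + v) (g + k) := by
  refine ⟨hu.1.add hv.1, fun x hx => ?_⟩
  have hsub : uIcc a x ⊆ uIcc a b := by
    rw [uIcc_of_le hx.1, uIcc_of_le (hx.1.trans hx.2)]
    exact Icc_subset_Icc_right hx.2
  have h1 := hu.1.mono_set hsub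
  have h2 := hv.1.mono_set hsub
  simp only [Pi.add_apply]
  rw [intervalIntegral.integral_add h1 h2, hu.2 x hx, hv.2 x hx]
  abel

theorem InV.add {h θ : ℝ} {u g v k : ℝ → ℂ} (hu : InV h θ u g) (hv : InV h θ v k) :
    InV h θ (u + v) (g + k) := by
  refine ⟨⟨⟨hu.1.1.1.add hv.1.1.1, hu.1.1.2.add hv.1.1.2⟩, ?_⟩, ?_⟩
  · simp only [Pi.add_apply]
    rw [hu.1.2, hv.1.2]
    ring
  · filter_upwards [hu.2, hv.2] with y h1 h2
    simp [h1, h2]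

theorem InV.smul {h θ : ℝ} {u g : ℝ → ℂ} (c : ℂ) (hu : InV h θ u g) :
    InV h θ (c • u) (c • g) := by
  refine ⟨⟨⟨⟨hu.1.1.1.1.smul c, fun x hx => ?_⟩, hu.1.1.2.const_smul c⟩, ?_⟩, ?_⟩
  · simp only [Pi.smul_apply]
    rw [intervalIntegral.integral_smul, hu.1.1.1.2 x hx, smul_add]
  · simp only [Pi.smul_apply, smul_eq_mul]
    rw [hu.1.2]
    ring
  · filter_upwards [hu.2] with y h1
    simp [h1]

theorem InV.zero (h θ : ℝ) : InV h θ 0 0 := by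
  exact ⟨⟨⟨⟨intervalIntegrable_const (c := (0 : ℂ)), fun x _ => by simp⟩, MemLp.zero⟩, by simp⟩,
    by simp⟩

/-- `V_θ` as a subspace of `L²_ρ(Y)`. -/
def VSub (h : ℝ) (ρ₀ ρ₁ : ℝ → ℝ) (θ : ℝ) : Submodule ℂ (CellL2 h ρ₀ ρ₁) where
  carrier := {f | ∃ u g, InV h θ u g ∧ f =ᵐ[cellMeasure h ρ₀ ρ₁] u}
  add_mem' := by
    rintro f₁ f₂ ⟨u, g, hu, hf⟩ ⟨v, k, hv, hf'⟩
    exact ⟨u + v, g + k, hu.add hv, (Lp.coeFn_add f₁ f₂).trans (hf.add hf')⟩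
  zero_mem' := ⟨0, 0, InV.zero h θ, Lp.coeFn_zero _ _ _⟩
  smul_mem' := by
    rintro c f ⟨u, g, hu, hf⟩
    exact ⟨c • u, c • g, hu.smul c, (Lp.coeFn_smul c f).trans (hf.const_smul c)⟩

/-- The Hilbert space in which `A_θ` acts: the closure of `V_θ` in `L²_ρ(Y)`. -/
abbrev VClosure (h : ℝ) (ρ₀ ρ₁ : ℝ → ℝ) (θ : ℝ) : Submodule ℂ (CellL2 h ρ₀ ρ₁) :=
  (VSub h ρ₀ ρ₁ θ).topologicalClosure

/-- The graph of `A_θ`: `A_θ u = f` means that `u ∈ V_θ` and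
`∫_{Y₀} a₀ u' conj(v') = ∫_Y ρ f conj(v)` for every `v ∈ V_θ`. -/
def LimitOp (h : ℝ) (a₀ ρ₀ ρ₁ : ℝ → ℝ) (θ : ℝ) (u f : VClosure h ρ₀ ρ₁ θ) : Prop :=
  ∃ w g : ℝ → ℂ, InV h θ w g ∧ (u : CellL2 h ρ₀ ρ₁) =ᵐ[cellMeasure h ρ₀ ρ₁] w ∧
    ∀ v k : ℝ → ℂ, InV h θ v k →
      ∫ y in Ioo 0 h, (a₀ y : ℂ) * g y * (starRingEnd ℂ) (k y) =
        ∫ y in Ioo 0 1, (cellDensity h ρ₀ ρ₁ y : ℂ) * (f : CellL2 h ρ₀ ρ₁) y *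
          (starRingEnd ℂ) (v y)

/-- The spectrum of a (possibly unbounded) operator `T` in `H`, given by its graph
`T u f ↔ T u = f`: `z` is outside the spectrum iff `T - z` is a bijection from the domain of `T`
onto `H` with a bounded inverse `R`, that is, `(T - z) u = f ↔ u = R f`. -/
def opSpectrum {H : Type*} [NormedAddCommGroup H] [NormedSpace ℂ H] (T : H → H → Prop) : Set ℂ :=
  {z | ¬ ∃ R : H →L[ℂ] H, ∀ u f : H, T u (f + z • u) ↔ u = R f}

/-- The spectrum `σ(A_θ)`. -/
def fibreSpectrum (h : ℝ) (a₀ ρ₀ ρ₁ : ℝ → ℝ) (θ : ℝ) : Set ℂ :=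
  opSpectrum (LimitOp h a₀ ρ₀ ρ₁ θ)

/-- The limit spectrum, the union of `σ(A_θ)` over `θ ∈ [0, 2π)`. -/
def limitSpectrum (h : ℝ) (a₀ ρ₀ ρ₁ : ℝ → ℝ) : Set ℂ :=
  ⋃ θ ∈ Ico (0 : ℝ) (2 * Real.pi), fibreSpectrum h a₀ ρ₀ ρ₁ θ

/-- `v` solves `-(a₀ v')' = lam ρ₀ v` on `(0, h)`, and `w` is the absolutely continuous version
on `[0, h]` of its co-derivative `a₀ v'`. -/
def IsSolution (h : ℝ) (a₀ ρ₀ : ℝ → ℝ) (lam : ℝ) (v w : ℝ → ℝ) : Prop :=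
  (∃ g : ℝ → ℝ, ACWith 0 h v g ∧ ∀ᵐ y ∂(volume.restrict (Ioo 0 h)), w y = a₀ y * g y) ∧
    ACWith 0 h w fun y => -(lam * ρ₀ y * v y)

/-- The canonical fundamental system `v₁, v₂`, with co-derivatives `w₁ = a₀ v₁'`, `w₂ = a₀ v₂'`. -/
structure IsFundamentalSystem (h : ℝ) (a₀ ρ₀ : ℝ → ℝ) (lam : ℝ) (v₁ w₁ v₂ w₂ : ℝ → ℝ) :
    Prop where
  sol₁ : IsSolution h a₀ ρ₀ lam v₁ w₁
  sol₂ : IsSolution h a₀ ρ₀ lam v₂ w₂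
  v₁_zero : v₁ 0 = 1
  w₁_zero : w₁ 0 = 0
  v₂_zero : v₂ 0 = 0
  w₂_zero : w₂ 0 = 1

/-- `Φ n` is an `L²_{ρ₀}(Y₀)`-orthonormal, complete sequence of eigenfunctions, with eigenvalues
`μ n`, of the operator associated with the form `∫_{Y₀} a₀ u' conj(v')` on `H¹_θ(Y₀)`. -/
structure IsEigensystem (h : ℝ) (a₀ ρ₀ : ℝ → ℝ) (θ : ℝ) (μ : ℕ → ℝ) (Φ : ℕ → ℝ → ℂ) :
    Prop where
  eigen : ∀ n, ∃ g, H1QuasiPer h θ (Φ n) g ∧ ∀ v k : ℝ → ℂ, H1QuasiPer h θ v k →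
    ∫ y in Ioo 0 h, (a₀ y : ℂ) * g y * (starRingEnd ℂ) (k y) =
      (μ n : ℂ) * ∫ y in Ioo 0 h, (ρ₀ y : ℂ) * Φ n y * (starRingEnd ℂ) (v y)
  orthonormal : ∀ m n, ∫ y in Ioo 0 h, (ρ₀ y : ℂ) * Φ m y * (starRingEnd ℂ) (Φ n y) =
    if m = n then 1 else 0
  complete : ∀ f : ℝ → ℂ, MemLp f 2 (volume.restrict (Ioo 0 h)) →
    (∀ n, ∫ y in Ioo 0 h, (ρ₀ y : ℂ) * f y * (starRingEnd ℂ) (Φ n y) = 0) →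
      f =ᵐ[volume.restrict (Ioo 0 h)] 0

end HighContrast

end

/-! An element of `V_θ` is constant on `Y₁`, with value `u(1) = e^{iθ} u(0)`. It is therefore
determined by its restriction to `(0, h)`, which satisfies `u(h) = e^{iθ} u(0)`, and `Y₁` enters the
right-hand side only as a point mass `M = ∫_{Y₁} ρ₁` at the end point (`limitOp_iff`). Integration
by parts turns `(A_θ - z) u = f` into the system `u' = w / a₀`, `w' = -ρ₀ (z u + f)` with two
boundary conditions, on `u(h)` and on the flux jump `w(h) e^{-iθ} - w(0)`. In terms of the Cauchy
data `(u(0), w(0))` these form a 2×2 linear system. As the Wronskian is 1, its determinant is `2 cos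
θ - (v₁(h) + w₂(h) - z M v₂(h))` (`IsFund.det_eq`).

If the determinant vanishes, `z` is an eigenvalue. Otherwise the equation is uniquely solvable for
every `f`. Boundedness of the inverse is then automatic: the solution operators at `z` and `conj z`
are adjoint to each other, and an everywhere defined operator with an adjoint is bounded
(`exists_clm_of_adjoint`). Testing an eigenfunction with itself shows that eigenvalues are real and
non-negative. Letting `θ` vary gives the condition `|…| ≤ 2`.

For the series, drop the point mass and put a unit source at the end point. The solution has `u(0) =
v₂(h) / (v₁(h) + w₂(h) - 2 cos θ)`, while its expansion coefficients are `conj (Φₙ(0)) / (μₙ - λ)`.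
Evaluating the expansion at `0` is legitimate because the partial sums are bounded in energy and
converge in `L²` (`IsEigensystem.hasSum_apply_zero`). Equating `λ` times this value to `1 / M` is a
rearrangement of the dispersion relation. A spectral `λ` equal to some `μₙ(θ)` satisfies that
relation both with `M` and with `0` in place of `M`, which leads to the excluded case. -/

noncomputable section

namespace HighContrast

open Filter Topology ComplexConjugate
open scoped InnerProductSpace

/-! ### Calculus of absolutely continuous functions. -/

section AbsolutelyContinuous

variable {E F : Type*} [NormedAddCommGroup E] [NormedSpace ℝ E] [NormedAddCommGroup F]
  [NormedSpace ℝ F] {a b : ℝ}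

theorem ACWith.integrableOn {u g : ℝ → E} (hu : ACWith a b u g) (hab : a ≤ b) :
    IntegrableOn g (Ioo a b) :=
  (intervalIntegrable_iff_integrableOn_Ioo_of_le hab).1 hu.1

theorem ACWith.setIntegral_deriv {u g : ℝ → E} (hu : ACWith a b u g) (hab : a ≤ b) :
    ∫ t in Ioo a b, g t = u b - u a := by
  rw [hu.2 b (right_mem_Icc.2 hab), intervalIntegral.integral_of_le hab,
    integral_Ioc_eq_integral_Ioo, add_sub_cancel_left]

theorem ACWith.mono {u g : ℝ → E} (hu : ACWith a b u g) {c : ℝ} (hac : a ≤ c) (hcb : c ≤ b) :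
    ACWith a c u g := by
  refine ⟨hu.1.mono_set ?_, fun x hx => hu.2 x ⟨hx.1, hx.2.trans hcb⟩⟩
  rw [uIcc_of_le hac, uIcc_of_le (hac.trans hcb)]
  exact Icc_subset_Icc_right hcb

theorem ACWith.intervalIntegrable_of_mem {u g : ℝ → E} (hu : ACWith a b u g) {x y : ℝ}
    (hx : x ∈ Icc a b) (hy : y ∈ Icc a b) : IntervalIntegrable g volume x y := by
  have hab : a ≤ b := hx.1.trans hx.2
  refine hu.1.mono_set ?_
  rw [uIcc_of_le hab]
  exact (convex_Icc a b).ordConnected.uIcc_subset hx hy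

theorem ACWith.sub_eq_integral {u g : ℝ → E} (hu : ACWith a b u g) {x y : ℝ}
    (hx : x ∈ Icc a b) (hy : y ∈ Icc a b) : u y - u x = ∫ t in x..y, g t := by
  have hab : a ≤ b := hx.1.trans hx.2
  have ha : a ∈ Icc a b := left_mem_Icc.2 hab
  rw [hu.2 y hy, hu.2 x hx, ← intervalIntegral.integral_add_adjacent_intervals
    (hu.intervalIntegrable_of_mem ha hx) (hu.intervalIntegrable_of_mem hx hy)]
  abel

theorem ACWith.continuousOn {u g : ℝ → E} (hu : ACWith a b u g) : ContinuousOn u (Icc a b) := by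
  rcases le_or_gt a b with hab | hab
  · have h1 : ContinuousOn (fun x => u a + ∫ t in a..x, g t) (Icc a b) := by
      refine continuousOn_const.add ?_
      have := intervalIntegral.continuousOn_primitive_interval'
        (f := g) (a := a) (b₁ := a) (b₂ := b) hu.1 (by simp)
      rwa [uIcc_of_le hab] at this
    exact h1.congr hu.2
  · simp [Icc_eq_empty (not_le.2 hab)]

theorem ACWith.congr {u v g k : ℝ → E} (hu : ACWith a b u g) (hab : a ≤ b)
    (huv : ∀ x ∈ Icc a b, v x = u x) (hgk : k =ᵐ[volume.restrict (Ioo a b)] g) :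
    ACWith a b v k := by
  have hk : g =ᵐ[volume.restrict (Ioc a b)] k := by
    rw [← Measure.restrict_congr_set (Ioo_ae_eq_Ioc (μ := volume) (a := a) (b := b))]
    exact hgk.symm
  refine ⟨?_, fun x hx => ?_⟩
  · rw [intervalIntegrable_iff_integrableOn_Ioo_of_le hab]
    exact (hu.integrableOn hab).congr_fun_ae hgk.symm
  · rw [huv x hx, huv a (left_mem_Icc.2 hab), hu.2 x hx]
    congr 1
    rw [intervalIntegral.integral_of_le hx.1, intervalIntegral.integral_of_le hx.1]
    refine integral_congr_ae (?_ : g =ᵐ[volume.restrict (Ioc a x)] k)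
    exact ae_restrict_of_ae_restrict_of_subset (Ioc_subset_Ioc_right hx.2) hk

theorem ACWith.clm_comp [CompleteSpace E] [CompleteSpace F] {u g : ℝ → E} (hu : ACWith a b u g)
    (L : E →L[ℝ] F) :
    ACWith a b (fun x => L (u x)) (fun x => L (g x)) := by
  refine ⟨⟨L.integrable_comp hu.1.1, L.integrable_comp hu.1.2⟩, fun x hx => ?_⟩
  have hi : IntervalIntegrable g volume a x :=
    hu.intervalIntegrable_of_mem (left_mem_Icc.2 (hx.1.trans hx.2)) hx
  simp only
  rw [hu.2 x hx, map_add, ContinuousLinearMap.intervalIntegral_comp_comm L hi]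

/-- Increments of `u` are dominated by those of the primitive of `‖g‖`, so the vector-valued case
reduces to a real primitive. -/
theorem ACWith.absolutelyContinuousOnInterval {u g : ℝ → E} (hu : ACWith a b u g) (hab : a ≤ b) :
    AbsolutelyContinuousOnInterval u a b := by
  have hN := hu.1.norm.absolutelyContinuousOnInterval_intervalIntegral (c := a) (by simp)
  rw [absolutelyContinuousOnInterval_iff] at hN ⊢
  intro ε hε
  obtain ⟨δ, hδ, H⟩ := hN ε hε
  refine ⟨δ, hδ, fun I hI hlt => lt_of_le_of_lt (Finset.sum_le_sum fun i hi => ?_) (H I hI hlt)⟩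
  have hmem := hI.1 i hi
  rw [uIcc_of_le hab] at hmem
  have ha : a ∈ Icc a b := left_mem_Icc.2 hab
  have h1 := hu.intervalIntegrable_of_mem ha hmem.1
  have h2 := hu.intervalIntegrable_of_mem ha hmem.2
  rw [dist_eq_norm, dist_eq_norm, hu.sub_eq_integral hmem.2 hmem.1,
    intervalIntegral.integral_interval_sub_left h1.norm h2.norm]
  exact intervalIntegral.norm_integral_le_abs_integral_norm

theorem ACWith.ae_hasDerivAt [CompleteSpace E] {u g : ℝ → E} (hu : ACWith a b u g) (hab : a ≤ b) :
    ∀ᵐ x, x ∈ Ioo a b → HasDerivAt u (g x) x := by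
  filter_upwards [hu.1.ae_hasDerivAt_integral] with x hx hxm
  have h1 := (hx (by rw [uIcc_of_le hab]; exact Ioo_subset_Icc_self hxm) a
    (by simp)).const_add (u a)
  refine h1.congr_of_eventuallyEq ?_
  filter_upwards [isOpen_Ioo.mem_nhds hxm] with y hy using hu.2 y (Ioo_subset_Icc_self hy)

/-- The product minus the primitive of the Leibniz expression is absolutely continuous with zero
derivative almost everywhere, hence constant. Every integration by parts and Wronskian identity
below rests on this. -/
theorem ACWith.mul {u g v k : ℝ → ℂ} (hu : ACWith a b u g) (hv : ACWith a b v k) (hab : a ≤ b) :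
    ACWith a b (fun x => u x * v x) (fun x => g x * v x + u x * k x) := by
  have hcu : ContinuousOn u (uIcc a b) := by rw [uIcc_of_le hab]; exact hu.continuousOn
  have hcv : ContinuousOn v (uIcc a b) := by rw [uIcc_of_le hab]; exact hv.continuousOn
  have hI : IntervalIntegrable (fun x => g x * v x + u x * k x) volume a b :=
    (hu.1.mul_continuousOn hcv).add (hv.1.continuousOn_mul hcu)
  let W : ℝ → ℂ := fun x => ∫ t in a..x, (g t * v t + u t * k t)
  have hW : ACWith a b W (fun x => g x * v x + u x * k x) := ⟨hI, fun x _ => by simp [W]⟩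
  have hac : AbsolutelyContinuousOnInterval (fun x => u x • v x - W x) a b :=
    ((hu.absolutelyContinuousOnInterval hab).smul (hv.absolutelyContinuousOnInterval hab)).sub
      (hW.absolutelyContinuousOnInterval hab)
  obtain ⟨C, hC⟩ := hac.const_of_ae_hasDerivAt_zero (by
    have hna : ∀ᵐ x : ℝ, x ≠ a := by simp [ae_iff, measure_singleton]
    have hnb : ∀ᵐ x : ℝ, x ≠ b := by simp [ae_iff, measure_singleton]
    filter_upwards [hu.ae_hasDerivAt hab, hv.ae_hasDerivAt hab, hW.ae_hasDerivAt hab, hna, hnb]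
      with x h1 h2 h3 h4 h5 hx
    rw [uIcc_of_le hab] at hx
    have hx' : x ∈ Ioo a b := ⟨lt_of_le_of_ne hx.1 (Ne.symm h4), lt_of_le_of_ne hx.2 h5⟩
    have := ((h1 hx').mul (h2 hx')).sub (h3 hx')
    rw [sub_self] at this
    exact this)
  refine ⟨hI, fun x hx => ?_⟩
  have h1 := hC x (by rwa [uIcc_of_le hab])
  have h2 := hC a (by simp)
  simp only [W, smul_eq_mul, intervalIntegral.integral_same, sub_zero] at h1 h2
  simp only
  rw [h2, ← h1]; ring

theorem ACWith.sub {u g v k : ℝ → E} (hu : ACWith a b u g) (hv : ACWith a b v k) :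
    ACWith a b (u - v) (g - k) := by
  refine ⟨hu.1.sub hv.1, fun x hx => ?_⟩
  have ha := left_mem_Icc.2 (hx.1.trans hx.2)
  simp only [Pi.sub_apply]
  rw [intervalIntegral.integral_sub (hu.intervalIntegrable_of_mem ha hx)
    (hv.intervalIntegrable_of_mem ha hx), hu.2 x hx, hv.2 x hx]
  abel

theorem ACWith.eq_of_deriv_eq_zero {u g : ℝ → E} (hu : ACWith a b u g)
    (hg : g =ᵐ[volume.restrict (Ioo a b)] 0) {x : ℝ} (hx : x ∈ Icc a b) : u x = u a := by
  have hab := hx.1.trans hx.2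
  have := hu.congr hab (fun _ _ => rfl) (k := 0) hg.symm
  rw [this.2 x hx]; simp

end AbsolutelyContinuous

/-! ### Carathéodory existence by a weighted contraction. -/

section Caratheodory

variable {E : Type*} [NormedAddCommGroup E] [NormedSpace ℝ E] [CompleteSpace E]

theorem integral_exp_mul_sub (a x l : ℝ) (hl : l ≠ 0) :
    ∫ t in a..x, Real.exp (l * (t - a)) = (Real.exp (l * (x - a)) - 1) / l := by
  have : ∀ t ∈ uIcc a x, HasDerivAt (fun t => Real.exp (l * (t - a)) / l)
      (Real.exp (l * (t - a))) t := by
    intro t _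
    have h1 : HasDerivAt (fun t => l * (t - a)) (l * 1) t :=
      ((hasDerivAt_id t).sub_const a).const_mul l
    have h2 := h1.exp.div_const l
    rwa [mul_one, mul_div_cancel_right₀ _ hl] at h2
  rw [intervalIntegral.integral_eq_sub_of_hasDerivAt this
    (Continuous.intervalIntegrable (by fun_prop) _ _)]
  simp; ring

/-- Global existence for a Carathéodory system with a uniformly Lipschitz right-hand side. -/
theorem exists_acWith_of_lipschitz {a b L : ℝ} (hab : a ≤ b) (f : ℝ → E → E)
    (hint : ∀ y : ℝ → E, Continuous y → IntervalIntegrable (fun t => f t (y t)) volume a b)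
    (hlip : ∀ᵐ t ∂volume.restrict (Ioc a b), ∀ x y, ‖f t x - f t y‖ ≤ L * ‖x - y‖) (y₀ : E) :
    ∃ y : ℝ → E, Continuous y ∧ ACWith a b y (fun t => f t (y t)) ∧ y a = y₀ := by
  obtain ⟨l, hl, hLl⟩ : ∃ l : ℝ, 0 < l ∧ L ≤ l := ⟨|L| + 1, by positivity,
    (le_abs_self L).trans (by linarith)⟩
  let X := C(Icc a b, E)
  -- Bielecki's weight: writing the unknown as `e • Y` makes the sup norm of `Y` an exponentially
  -- weighted norm. With rate `2 * l` the Picard map contracts by `l / (2 * l) = 1 / 2` on the whole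
  -- interval, so no subdivision is needed.
  let e : ℝ → ℝ := fun t => Real.exp (2 * l * (t - a))
  have he : Continuous e := by fun_prop
  have hepos : ∀ t, 0 < e t := fun t => Real.exp_pos _
  let ext : X → ℝ → E := fun Y t => e t • IccExtend hab Y t
  have hext : ∀ Y : X, Continuous (ext Y) := fun Y => he.smul Y.continuous.Icc_extend'
  have hprim : ∀ Y : X, ACWith a b (fun x => y₀ + ∫ t in a..x, f t (ext Y t))
      (fun t => f t (ext Y t)) := fun Y => ⟨hint _ (hext Y), fun x _ => by simp⟩
  let T : X → X := fun Y =>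
    ⟨fun x => (e x)⁻¹ • (y₀ + ∫ t in a..(x : ℝ), f t (ext Y t)), by
      have h1 : Continuous fun x : Icc a b => y₀ + ∫ t in a..(x : ℝ), f t (ext Y t) :=
        (hprim Y).continuousOn.comp_continuous continuous_subtype_val fun x => x.2
      have h2 : Continuous fun x : Icc a b => (e x)⁻¹ :=
        (he.comp continuous_subtype_val).inv₀ fun x => (hepos _).ne'
      exact h2.smul h1⟩
  have hTapp : ∀ (Y : X) (x : Icc a b),
      T Y x = (e x)⁻¹ • (y₀ + ∫ t in a..(x : ℝ), f t (ext Y t)) := fun _ _ => rfl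
  have hT : ContractingWith (1 / 2) T := by
    refine ⟨by rw [← NNReal.coe_lt_coe]; norm_num, LipschitzWith.of_dist_le_mul fun Y Z => ?_⟩
    rw [ContinuousMap.dist_le (by positivity)]
    intro x
    have hxm := x.2
    have hsub : Ioc a (x : ℝ) ⊆ Ioc a b := Ioc_subset_Ioc_right hxm.2
    have ha : a ∈ Icc a b := left_mem_Icc.2 hab
    have hYi := (hprim Y).intervalIntegrable_of_mem ha hxm
    have hZi := (hprim Z).intervalIntegrable_of_mem ha hxm
    have hd : dist (T Y x) (T Z x) =
        (e x)⁻¹ * ‖∫ t in a..(x : ℝ), (f t (ext Y t) - f t (ext Z t))‖ := by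
      rw [intervalIntegral.integral_sub hYi hZi, dist_eq_norm]
      rw [hTapp, hTapp, ← smul_sub, norm_smul, add_sub_add_left_eq_sub, Real.norm_of_nonneg
        (inv_nonneg.2 (hepos _).le)]
    have hle : ‖∫ t in a..(x : ℝ), (f t (ext Y t) - f t (ext Z t))‖ ≤
        ∫ t in a..(x : ℝ), l * dist Y Z * e t := by
      refine intervalIntegral.norm_integral_le_of_norm_le hxm.1 ?_
        (Continuous.intervalIntegrable (by fun_prop) _ _)
      rw [← ae_restrict_iff' measurableSet_Ioc]
      filter_upwards [ae_restrict_of_ae_restrict_of_subset hsub hlip] with t ht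
      refine (ht _ _).trans ?_
      have h1 : ‖ext Y t - ext Z t‖ ≤ e t * dist Y Z := by
        simp only [ext]
        rw [← smul_sub, norm_smul, Real.norm_of_nonneg (hepos t).le, ← dist_eq_norm]
        exact mul_le_mul_of_nonneg_left (ContinuousMap.dist_apply_le_dist _) (hepos t).le
      calc L * ‖ext Y t - ext Z t‖ ≤ l * (e t * dist Y Z) := by gcongr
        _ = _ := by ring
    rw [hd]
    have hval : ∫ t in a..(x : ℝ), l * dist Y Z * e t =
        l * dist Y Z * ((e x - 1) / (2 * l)) := by
      rw [intervalIntegral.integral_const_mul, integral_exp_mul_sub _ _ _ (by positivity)]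
    rw [hval] at hle
    calc (e x)⁻¹ * ‖∫ t in a..(x : ℝ), (f t (ext Y t) - f t (ext Z t))‖
        ≤ (e x)⁻¹ * (l * dist Y Z * (e x / (2 * l))) := by
          have := hepos x
          gcongr
          refine hle.trans ?_
          gcongr
          linarith
      _ = _ := by
          have := (hepos x).ne'
          push_cast
          field_simp
  have hne : Nonempty X := ⟨0⟩
  let Y := hT.fixedPoint
  have hY : T Y = Y := hT.fixedPoint_isFixedPt
  have key : ∀ x ∈ Icc a b, ext Y x = y₀ + ∫ t in a..x, f t (ext Y t) := by
    intro x hx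
    have h1 : T Y ⟨x, hx⟩ = Y ⟨x, hx⟩ := by rw [hY]
    simp only [ext]
    rw [IccExtend_of_mem hab _ hx, ← h1]
    rw [hTapp, smul_smul, mul_inv_cancel₀ (hepos x).ne', one_smul]
  have h0 : ext Y a = y₀ := by rw [key a (left_mem_Icc.2 hab)]; simp
  exact ⟨ext Y, hext Y, ⟨hint _ (hext Y), fun x hx => by rw [h0]; exact key x hx⟩, h0⟩

end Caratheodory

/-! ### Bounded, uniformly positive coefficients. -/

section Coefficients

variable {s : Set ℝ} {ρ : ℝ → ℝ}

theorem UnifPosBdd.inv (hρ : UnifPosBdd ρ s) : UnifPosBdd (fun x => (ρ x)⁻¹) s := by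
  obtain ⟨hm, c, C, hc, hb⟩ := hρ
  -- The maximum with `c` keeps the lower bound positive even when `s` is null, in which case `C` is
  -- not forced to be positive.
  refine ⟨hm.inv, (max C c)⁻¹, c⁻¹, by positivity, ?_⟩
  filter_upwards [hb] with x hx
  have : 0 < ρ x := hc.trans_le hx.1
  exact ⟨inv_anti₀ this (hx.2.trans (le_max_left _ _)), inv_anti₀ hc hx.1⟩

theorem UnifPosBdd.aestronglyMeasurable_ofReal (hρ : UnifPosBdd ρ s) :
    AEStronglyMeasurable (fun x => (ρ x : ℂ)) (volume.restrict s) :=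
  (Complex.measurable_ofReal.comp_aemeasurable hρ.1).aestronglyMeasurable

theorem UnifPosBdd.exists_bound (hρ : UnifPosBdd ρ s) :
    ∃ C : ℝ, 0 < C ∧ ∀ᵐ x ∂volume.restrict s, 0 < ρ x ∧ |ρ x| ≤ C := by
  obtain ⟨_, c, C, hc, hb⟩ := hρ
  refine ⟨max C 1, by positivity, ?_⟩
  filter_upwards [hb] with x hx
  have : 0 < ρ x := hc.trans_le hx.1
  exact ⟨this, by rw [abs_of_pos this]; exact hx.2.trans (le_max_left _ _)⟩

theorem UnifPosBdd.memLp_mul (hρ : UnifPosBdd ρ s) {p : ENNReal} {f : ℝ → ℂ}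
    (hf : MemLp f p (volume.restrict s)) :
    MemLp (fun x => (ρ x : ℂ) * f x) p (volume.restrict s) := by
  obtain ⟨C, -, hb⟩ := hρ.exists_bound
  refine hf.of_le_mul (c := C) (hρ.aestronglyMeasurable_ofReal.mul hf.1) ?_
  filter_upwards [hb] with x hx
  rw [norm_mul, Complex.norm_real, Real.norm_eq_abs]
  exact mul_le_mul_of_nonneg_right hx.2 (norm_nonneg _)

theorem UnifPosBdd.integrable_mul_mul_conj (hρ : UnifPosBdd ρ s) {f g : ℝ → ℂ}
    (hf : MemLp f 2 (volume.restrict s)) (hg : MemLp g 2 (volume.restrict s)) :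
    IntegrableOn (fun x => (ρ x : ℂ) * f x * conj (g x)) s :=
  (hρ.memLp_mul hf).integrable_mul hg.star

end Coefficients

theorem memLp_of_continuousOn {u : ℝ → ℂ} {a b : ℝ} (hu : ContinuousOn u (Icc a b))
    (p : ENNReal) : MemLp u p (volume.restrict (Ioo a b)) := by
  obtain ⟨C, hC⟩ := isCompact_Icc.exists_bound_of_continuousOn hu
  refine MemLp.of_bound ((hu.mono Ioo_subset_Icc_self).aestronglyMeasurable measurableSet_Ioo) C ?_
  filter_upwards [ae_restrict_mem measurableSet_Ioo] with x hx using hC x (Ioo_subset_Icc_self hx)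

theorem integrableOn_of_memLp_two {f : ℝ → ℂ} {a b : ℝ}
    (hf : MemLp f 2 (volume.restrict (Ioo a b))) : IntegrableOn f (Ioo a b) :=
  hf.integrable (by norm_num)

theorem ACWith.conj {a b : ℝ} {u g : ℝ → ℂ} (hu : ACWith a b u g) :
    ACWith a b (fun x => conj (u x)) (fun x => conj (g x)) :=
  hu.clm_comp Complex.conjCLE.toContinuousLinearMap

theorem memLp_conj {μ : Measure ℝ} {p : ENNReal} {f : ℝ → ℂ} (hf : MemLp f p μ) :
    MemLp (fun x => conj (f x)) p μ := hf.star

/-- `(u, w)` solves the first-order system `u' = w / a`, `w' = -ρ (z u + F)` on `(0, h)`. -/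
def IsSol (h : ℝ) (a ρ : ℝ → ℝ) (z : ℂ) (F u w : ℝ → ℂ) : Prop :=
  ACWith 0 h u (fun x => ((a x)⁻¹ : ℝ) * w x) ∧
    ACWith 0 h w (fun x => -((ρ x : ℂ) * (z * u x + F x)))

/-! ### The first-order system, Wronskians and fundamental systems. -/

section System

variable {h : ℝ} {a ρ : ℝ → ℝ} {z : ℂ}

/-- The coefficients are merely measurable, but the right-hand side is uniformly Lipschitz in the
pair `(u, w)`, so the Carathéodory theorem applies on `ℂ × ℂ`. -/
theorem exists_isSol (hh : 0 ≤ h) (ha : UnifPosBdd a (Ioo 0 h)) (hρ : UnifPosBdd ρ (Ioo 0 h))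
    (z : ℂ) {F : ℝ → ℂ} (hF : MemLp F 2 (volume.restrict (Ioo 0 h))) (α β : ℂ) :
    ∃ u w, IsSol h a ρ z F u w ∧ u 0 = α ∧ w 0 = β := by
  obtain ⟨A, hA, hAb⟩ := ha.inv.exists_bound
  obtain ⟨R, hR, hRb⟩ := hρ.exists_bound
  let f : ℝ → ℂ × ℂ → ℂ × ℂ := fun t p =>
    ((((a t)⁻¹ : ℝ) : ℂ) * p.2, -((ρ t : ℂ) * (z * p.1 + F t)))
  have hint : ∀ y : ℝ → ℂ × ℂ, Continuous y →
      IntervalIntegrable (fun t => f t (y t)) volume 0 h := by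
    intro y hy
    rw [intervalIntegrable_iff_integrableOn_Ioo_of_le hh]
    have h1 : MemLp (fun t => (y t).1) 2 (volume.restrict (Ioo 0 h)) :=
      memLp_of_continuousOn hy.fst.continuousOn 2
    have h2 : MemLp (fun t => (y t).2) 2 (volume.restrict (Ioo 0 h)) :=
      memLp_of_continuousOn hy.snd.continuousOn 2
    exact (integrableOn_of_memLp_two (ha.inv.memLp_mul h2)).prodMk
      (integrableOn_of_memLp_two (hρ.memLp_mul ((h1.const_mul z).add hF)).neg)
  have hlip : ∀ᵐ t ∂volume.restrict (Ioc 0 h), ∀ p q,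
      ‖f t p - f t q‖ ≤ max A (R * ‖z‖) * ‖p - q‖ := by
    rw [← Measure.restrict_congr_set (Ioo_ae_eq_Ioc (μ := volume) (a := 0) (b := h))]
    filter_upwards [hAb, hRb] with t h1 h2 p q
    have e1 : ‖(f t p - f t q).1‖ ≤ A * ‖p - q‖ := by
      have : (f t p - f t q).1 = (((a t)⁻¹ : ℝ) : ℂ) * (p - q).2 := by
        simp only [f, Prod.fst_sub, Prod.snd_sub]; ring
      rw [this, norm_mul, Complex.norm_real, Real.norm_eq_abs]
      exact mul_le_mul h1.2 (norm_snd_le _) (norm_nonneg _) hA.le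
    have e2 : ‖(f t p - f t q).2‖ ≤ R * ‖z‖ * ‖p - q‖ := by
      have : (f t p - f t q).2 = -((ρ t : ℂ) * z * (p - q).1) := by
        simp only [f, Prod.fst_sub, Prod.snd_sub]; ring
      rw [this, norm_neg, norm_mul, norm_mul, Complex.norm_real, Real.norm_eq_abs]
      exact mul_le_mul (mul_le_mul_of_nonneg_right h2.2 (norm_nonneg _)) (norm_fst_le _)
        (norm_nonneg _) (by positivity)
    rw [Prod.norm_def]
    refine max_le (e1.trans ?_) (e2.trans ?_)
    · exact mul_le_mul_of_nonneg_right (le_max_left _ _) (norm_nonneg _)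
    · exact mul_le_mul_of_nonneg_right (le_max_right _ _) (norm_nonneg _)
  obtain ⟨y, -, hy, hy0⟩ := exists_acWith_of_lipschitz hh f hint hlip (α, β)
  exact ⟨fun t => (y t).1, fun t => (y t).2,
    ⟨hy.clm_comp (ContinuousLinearMap.fst ℝ ℂ ℂ), hy.clm_comp (ContinuousLinearMap.snd ℝ ℂ ℂ)⟩,
    by simp [hy0], by simp [hy0]⟩

theorem IsSol.add {F G u w v y : ℝ → ℂ} (hu : IsSol h a ρ z F u w) (hv : IsSol h a ρ z G v y)
    (hh : 0 ≤ h) : IsSol h a ρ z (F + G) (u + v) (w + y) := by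
  refine ⟨(hu.1.add hv.1).congr hh (fun _ _ => rfl) (.of_forall fun x => ?_),
    (hu.2.add hv.2).congr hh (fun _ _ => rfl) (.of_forall fun x => ?_)⟩ <;>
  simp only [Pi.add_apply] <;> ring

theorem ACWith.const_mul {b c : ℝ} {u g : ℝ → ℂ} (hu : ACWith b c u g) (k : ℂ) :
    ACWith b c (k • u) (k • g) :=
  hu.clm_comp (k • ContinuousLinearMap.id ℝ ℂ)

theorem IsSol.smul {F u w : ℝ → ℂ} (hu : IsSol h a ρ z F u w) (hh : 0 ≤ h) (c : ℂ) :
    IsSol h a ρ z (c • F) (c • u) (c • w) := by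
  refine ⟨(hu.1.const_mul c).congr hh (fun _ _ => rfl) (.of_forall fun x => ?_),
    (hu.2.const_mul c).congr hh (fun _ _ => rfl) (.of_forall fun x => ?_)⟩ <;>
  simp only [Pi.smul_apply, smul_eq_mul] <;> ring

theorem IsSol.wronskian {u w v y : ℝ → ℂ} (hu : IsSol h a ρ z 0 u w) (hv : IsSol h a ρ z 0 v y)
    {x : ℝ} (hx : x ∈ Icc 0 h) : u x * y x - w x * v x = u 0 * y 0 - w 0 * v 0 := by
  have hh : 0 ≤ h := hx.1.trans hx.2
  have := (hu.1.mul hv.2 hh).sub (hu.2.mul hv.1 hh)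
  refine this.eq_of_deriv_eq_zero (.of_forall fun t => ?_) hx
  simp only [Pi.sub_apply, Pi.zero_apply]
  ring

/-- A complex fundamental system normalised at `0`. -/
structure IsFund (h : ℝ) (a ρ : ℝ → ℝ) (z : ℂ) (v₁ w₁ v₂ w₂ : ℝ → ℂ) : Prop where
  sol₁ : IsSol h a ρ z 0 v₁ w₁
  sol₂ : IsSol h a ρ z 0 v₂ w₂
  v₁_zero : v₁ 0 = 1
  w₁_zero : w₁ 0 = 0
  v₂_zero : v₂ 0 = 0
  w₂_zero : w₂ 0 = 1

theorem exists_isFund (hh : 0 ≤ h) (ha : UnifPosBdd a (Ioo 0 h)) (hρ : UnifPosBdd ρ (Ioo 0 h))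
    (z : ℂ) : ∃ v₁ w₁ v₂ w₂, IsFund h a ρ z v₁ w₁ v₂ w₂ := by
  obtain ⟨v₁, w₁, h1, h2, h3⟩ := exists_isSol hh ha hρ z (F := 0) MemLp.zero 1 0
  obtain ⟨v₂, w₂, h4, h5, h6⟩ := exists_isSol hh ha hρ z (F := 0) MemLp.zero 0 1
  exact ⟨v₁, w₁, v₂, w₂, h1, h4, h2, h3, h5, h6⟩

variable {v₁ w₁ v₂ w₂ : ℝ → ℂ}

theorem IsFund.wronskian (hf : IsFund h a ρ z v₁ w₁ v₂ w₂) {x : ℝ} (hx : x ∈ Icc 0 h) :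
    v₁ x * w₂ x - w₁ x * v₂ x = 1 := by
  rw [hf.sol₁.wronskian hf.sol₂ hx, hf.v₁_zero, hf.w₁_zero, hf.w₂_zero]; ring

/-- Cramer's rule applied to three constant Wronskians. This also yields uniqueness for the
homogeneous initial value problem without a Grönwall argument. -/
theorem IsFund.eq_combination (hf : IsFund h a ρ z v₁ w₁ v₂ w₂) {u w : ℝ → ℂ}
    (hu : IsSol h a ρ z 0 u w) {x : ℝ} (hx : x ∈ Icc 0 h) :
    u x = u 0 * v₁ x + w 0 * v₂ x ∧ w x = u 0 * w₁ x + w 0 * w₂ x := by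
  have h1 := hu.wronskian hf.sol₁ hx
  have h2 := hu.wronskian hf.sol₂ hx
  have h3 := hf.wronskian hx
  rw [hf.v₁_zero, hf.w₁_zero] at h1
  rw [hf.v₂_zero, hf.w₂_zero] at h2
  constructor
  · linear_combination (-u x) * h3 + v₁ x * h2 - v₂ x * h1
  · linear_combination (-w x) * h3 + w₁ x * h2 - w₂ x * h1

theorem IsFund.isSol_combination (hf : IsFund h a ρ z v₁ w₁ v₂ w₂) (hh : 0 ≤ h) (α β : ℂ) :
    IsSol h a ρ z 0 (α • v₁ + β • v₂) (α • w₁ + β • w₂) := by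
  simpa using (hf.sol₁.smul hh α).add (hf.sol₂.smul hh β) hh

/-- If `u` vanishes then `w` is constant, and `0 = u(h) - u(0) = w(0) ∫ 1/a` with a positive
integral. This ensures that nontrivial Cauchy data give a nontrivial eigenfunction. -/
theorem IsSol.eq_zero_of_forall_eq_zero {u w : ℝ → ℂ} (hu : IsSol h a ρ z 0 u w) (hh : 0 < h)
    (ha : UnifPosBdd a (Ioo 0 h)) (h0 : ∀ x ∈ Icc 0 h, u x = 0) : w 0 = 0 := by
  have hw : ∀ x ∈ Icc 0 h, w x = w 0 := fun x hx => hu.2.eq_of_deriv_eq_zero (by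
    filter_upwards [ae_restrict_mem measurableSet_Ioo] with t ht
    simp [h0 t (Ioo_subset_Icc_self ht)]) hx
  have h1 := hu.1.setIntegral_deriv hh.le
  rw [h0 h (right_mem_Icc.2 hh.le), h0 0 (left_mem_Icc.2 hh.le), sub_zero,
    setIntegral_congr_fun measurableSet_Ioo
      (fun t ht => by rw [hw t (Ioo_subset_Icc_self ht)]), integral_mul_const] at h1
  rcases mul_eq_zero.1 h1 with h2 | h2
  · exfalso
    rw [integral_complex_ofReal, Complex.ofReal_eq_zero] at h2
    obtain ⟨C, hC, hb⟩ := ha.inv.exists_bound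
    have hi : IntegrableOn (fun x => (a x)⁻¹) (Ioo 0 h) :=
      Integrable.of_bound ha.inv.1.aestronglyMeasurable C (hb.mono fun x hx => hx.2)
    rw [setIntegral_eq_zero_iff_of_nonneg_ae (hb.mono fun x hx => hx.1.le) hi] at h2
    have : ∀ᵐ x ∂volume.restrict (Ioo 0 h), False := by
      filter_upwards [hb, h2] with x h3 h4
      exact h3.1.ne' h4
    rw [eventually_false_iff_eq_bot, ae_eq_bot, Measure.restrict_eq_zero] at this
    simp [hh.not_ge] at this
  · exact h2

end System

/-- The quasi-periodicity factor `e^{iθ}`. -/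
def phase (θ : ℝ) : ℂ := Complex.exp (Complex.I * θ)

theorem phase_mul_conj (θ : ℝ) : phase θ * conj (phase θ) = 1 := by
  rw [Complex.mul_conj, phase, mul_comm, Complex.normSq_eq_norm_sq, Complex.norm_exp_ofReal_mul_I]
  simp

theorem phase_add_conj (θ : ℝ) : phase θ + conj (phase θ) = ((2 * Real.cos θ : ℝ) : ℂ) := by
  rw [Complex.add_conj, phase, mul_comm Complex.I, Complex.exp_ofReal_mul_I_re]

theorem ae_eq_zero_of_integral_mul_conj_eq_zero {μ : Measure ℝ} {f : ℝ → ℂ} (hf : MemLp f 2 μ)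
    (h0 : ∫ x, f x * conj (f x) ∂μ = 0) : f =ᵐ[μ] 0 := by
  have h1 : ∫ x, ‖f x‖ ^ 2 ∂μ = 0 := by
    rw [← Complex.ofReal_eq_zero, ← integral_complex_ofReal, ← h0]
    refine integral_congr_ae (.of_forall fun x => ?_)
    simp only
    rw [Complex.mul_conj, Complex.normSq_eq_norm_sq]
  have hi : Integrable (fun x => ‖f x‖ ^ 2) μ := hf.norm.integrable_sq
  rw [integral_eq_zero_iff_of_nonneg (fun x => by positivity) hi] at h1
  filter_upwards [h1] with x hx
  simpa using hx

theorem eq_zero_of_ae_eq_zero {u : ℝ → ℂ} {h : ℝ} (hh : 0 < h) (hu : ContinuousOn u (Icc 0 h))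
    (h0 : u =ᵐ[volume.restrict (Ioo 0 h)] 0) : ∀ x ∈ Icc 0 h, u x = 0 := by
  rw [Measure.restrict_congr_set Ioo_ae_eq_Icc] at h0
  exact Measure.eqOn_Icc_of_ae_eq volume hh.ne h0 hu continuousOn_const

/-- `(u, u' = g)` is a weak solution, in the class of `θ`-quasi-periodic functions, of
`-(a u')' = ρ (z u + F)` with an additional point mass `d + z M u(0)` at the end point. -/
def WeakSol (h : ℝ) (a ρ : ℝ → ℝ) (θ : ℝ) (z : ℂ) (M : ℝ) (F : ℝ → ℂ) (d : ℂ) (u g : ℝ → ℂ) :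
    Prop :=
  H1QuasiPer h θ u g ∧ ∀ v k, H1QuasiPer h θ v k →
    ∫ y in Ioo 0 h, (a y : ℂ) * g y * conj (k y) =
      (∫ y in Ioo 0 h, (ρ y : ℂ) * (z * u y + F y) * conj (v y)) +
        (d + z * M * u 0) * conj (v 0)

/-- There is no nontrivial solution of the homogeneous problem. -/
def NoEigen (h : ℝ) (a ρ : ℝ → ℝ) (θ : ℝ) (z : ℂ) (M : ℝ) : Prop :=
  ∀ u g, WeakSol h a ρ θ z M 0 0 u g → ∀ x ∈ Icc 0 h, u x = 0

/-! ### The weak problem with a point mass and its 2×2 boundary system. -/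

section Weak

variable {h : ℝ} {a ρ : ℝ → ℝ} {θ : ℝ} {z : ℂ} {M : ℝ}

theorem H1QuasiPer.apply_end {u g : ℝ → ℂ} (hu : H1QuasiPer h θ u g) : u h = phase θ * u 0 := hu.2

theorem H1QuasiPer.memLp {u g : ℝ → ℂ} (hu : H1QuasiPer h θ u g) :
    MemLp u 2 (volume.restrict (Ioo 0 h)) := memLp_of_continuousOn hu.1.1.continuousOn 2

/-- Integration by parts. Quasi-periodicity of `v` merges the two boundary terms into the flux jump
times `conj (v 0)`. -/
theorem integral_mul_conj_deriv (hh : 0 ≤ h) (hρ : UnifPosBdd ρ (Ioo 0 h)) {q w v k : ℝ → ℂ}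
    (hq : MemLp q 2 (volume.restrict (Ioo 0 h)))
    (hw : ACWith 0 h w fun x => -((ρ x : ℂ) * q x)) (hv : H1QuasiPer h θ v k) :
    ∫ y in Ioo 0 h, w y * conj (k y) = (∫ y in Ioo 0 h, (ρ y : ℂ) * q y * conj (v y)) +
      (w h * conj (phase θ) - w 0) * conj (v 0) := by
  have h1 := (hw.mul hv.1.1.conj hh).setIntegral_deriv hh
  have i1 : IntegrableOn (fun x => (ρ x : ℂ) * q x * conj (v x)) (Ioo 0 h) :=
    hρ.integrable_mul_mul_conj hq hv.memLp
  have i2 : IntegrableOn (fun x => w x * conj (k x)) (Ioo 0 h) :=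
    (memLp_of_continuousOn hw.continuousOn 2).integrable_mul (memLp_conj hv.1.2)
  have h2 : ∫ t in Ioo 0 h, (-((ρ t : ℂ) * q t) * conj (v t) + w t * conj (k t)) =
      (∫ t in Ioo 0 h, w t * conj (k t)) - ∫ t in Ioo 0 h, (ρ t : ℂ) * q t * conj (v t) := by
    rw [← integral_sub i2 i1]
    refine integral_congr_ae (.of_forall fun t => ?_)
    simp only; ring
  rw [h2, hv.apply_end, map_mul] at h1
  linear_combination h1

theorem IsSol.weakSol (hh : 0 ≤ h) (ha : UnifPosBdd a (Ioo 0 h)) (hρ : UnifPosBdd ρ (Ioo 0 h))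
    {F u w : ℝ → ℂ} {d : ℂ} (hF : MemLp F 2 (volume.restrict (Ioo 0 h)))
    (hs : IsSol h a ρ z F u w) (hper : u h = phase θ * u 0)
    (hjump : w h * conj (phase θ) - w 0 = d + z * M * u 0) :
    WeakSol h a ρ θ z M F d u (fun x => ((a x)⁻¹ : ℝ) * w x) := by
  refine ⟨⟨⟨hs.1, ha.inv.memLp_mul (memLp_of_continuousOn hs.2.continuousOn 2)⟩, hper⟩,
    fun v k hv => ?_⟩
  have hq : MemLp (fun x => z * u x + F x) 2 (volume.restrict (Ioo 0 h)) :=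
    ((memLp_of_continuousOn hs.1.continuousOn 2).const_mul z).add hF
  rw [← hjump, ← integral_mul_conj_deriv hh hρ hq hs.2 hv]
  obtain ⟨C, -, hb⟩ := ha.exists_bound
  refine integral_congr_ae ?_
  filter_upwards [hb] with x hx
  have : (a x : ℂ) ≠ 0 := Complex.ofReal_ne_zero.2 hx.1.ne'
  rw [Complex.ofReal_inv]
  field_simp

/-- The du Bois-Reymond argument. With `W` a primitive of `-ρ (z u + F)`, testing with functions
vanishing at both ends shows that `a g - W` is orthogonal to all mean-zero functions, hence
constant. The flux is `W` plus that constant. -/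
theorem WeakSol.exists_isSol (hh : 0 < h) (ha : UnifPosBdd a (Ioo 0 h))
    (hρ : UnifPosBdd ρ (Ioo 0 h)) {F u g : ℝ → ℂ} {d : ℂ}
    (hF : MemLp F 2 (volume.restrict (Ioo 0 h))) (hu : WeakSol h a ρ θ z M F d u g) :
    ∃ w, IsSol h a ρ z F u w ∧ w h * conj (phase θ) - w 0 = d + z * M * u 0 := by
  obtain ⟨hper, hweak⟩ := hu
  let p : ℝ → ℂ := fun x => z * u x + F x
  have hp : MemLp p 2 (volume.restrict (Ioo 0 h)) := (hper.memLp.const_mul z).add hF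
  let W : ℝ → ℂ := fun x => ∫ t in (0 : ℝ)..x, -((ρ t : ℂ) * p t)
  have hW : ACWith 0 h W fun x => -((ρ x : ℂ) * p x) := by
    refine ⟨?_, fun x _ => by simp [W]⟩
    rw [intervalIntegrable_iff_integrableOn_Ioo_of_le hh.le]
    exact (integrableOn_of_memLp_two (hρ.memLp_mul hp)).neg
  let q : ℝ → ℂ := fun x => (a x : ℂ) * g x - W x
  have hWp : MemLp W 2 (volume.restrict (Ioo 0 h)) := memLp_of_continuousOn hW.continuousOn 2
  have hag := ha.memLp_mul hper.1.2
  have hq : MemLp q 2 (volume.restrict (Ioo 0 h)) := hag.sub hWp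
  -- The mean of `q` is subtracted so that the primitive `v` of `k` vanishes at both ends and is
  -- admissible for every `θ`. Testing with it gives `∫ |k|² = 0`.
  let m : ℂ := (∫ x in Ioo 0 h, q x) / h
  let k : ℝ → ℂ := fun x => q x - m
  have hk : MemLp k 2 (volume.restrict (Ioo 0 h)) := hq.sub (memLp_const m)
  have hk0 : ∫ x in Ioo 0 h, k x = 0 := by
    simp only [k]
    rw [integral_sub (integrableOn_of_memLp_two hq) (integrable_const m)]
    have : (h : ℂ) ≠ 0 := Complex.ofReal_ne_zero.2 hh.ne'
    simp [m, Measure.real, ENNReal.toReal_ofReal hh.le]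
    field_simp
    ring
  let v : ℝ → ℂ := fun x => ∫ t in (0 : ℝ)..x, k t
  have hv : H1QuasiPer h θ v k := by
    refine ⟨⟨⟨?_, fun x _ => by simp [v]⟩, hk⟩, ?_⟩
    · rw [intervalIntegrable_iff_integrableOn_Ioo_of_le hh.le]
      exact integrableOn_of_memLp_two hk
    · simp only [v]
      rw [intervalIntegral.integral_of_le hh.le, integral_Ioc_eq_integral_Ioo, hk0]
      simp
  have hv0 : v 0 = 0 := by simp [v]
  have e1 := hweak v k hv
  have e2 := integral_mul_conj_deriv hh.le hρ hp hW hv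
  rw [hv0, map_zero, mul_zero, add_zero] at e1 e2
  have e3 : ∫ x in Ioo 0 h, k x * conj (k x) = 0 := by
    have i1 : IntegrableOn (fun x => (a x : ℂ) * g x * conj (k x)) (Ioo 0 h) :=
      hag.integrable_mul (memLp_conj hk)
    have i2 : IntegrableOn (fun x => W x * conj (k x)) (Ioo 0 h) :=
      hWp.integrable_mul (memLp_conj hk)
    have i3 : IntegrableOn (fun x => m * conj (k x)) (Ioo 0 h) :=
      (integrableOn_of_memLp_two (memLp_conj hk)).const_mul m
    have : ∀ x, k x * conj (k x) =
        (a x : ℂ) * g x * conj (k x) - W x * conj (k x) - m * conj (k x) := fun x => by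
      simp only [k, q]; ring
    simp_rw [this]
    rw [integral_sub (by exact i1.sub i2) i3, integral_sub i1 i2, e1, e2, integral_const_mul,
      integral_conj, hk0]
    simp [p]
  have hk' := ae_eq_zero_of_integral_mul_conj_eq_zero hk e3
  let w : ℝ → ℂ := fun x => W x + m
  have hw : ACWith 0 h w fun x => -((ρ x : ℂ) * p x) :=
    ⟨hW.1, fun x hx => by simp only [w]; rw [hW.2 x hx]; ring⟩
  have hwg : ∀ᵐ x ∂volume.restrict (Ioo 0 h), w x = (a x : ℂ) * g x := by
    filter_upwards [hk'] with x hx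
    simp only [k, q, Pi.zero_apply] at hx
    simp only [w]
    linear_combination -hx
  refine ⟨w, ⟨hper.1.1.congr hh.le (fun _ _ => rfl) ?_, hw⟩, ?_⟩
  · obtain ⟨C, -, hb⟩ := ha.exists_bound
    filter_upwards [hwg, hb] with x h1 h2
    have : (a x : ℂ) ≠ 0 := Complex.ofReal_ne_zero.2 h2.1.ne'
    rw [h1, Complex.ofReal_inv]
    field_simp
  -- The affine function from `1` to `phase θ` is an admissible test function with value `1` at `0`,
  -- so it reads off the jump condition.
  · have hv : H1QuasiPer h θ (fun x => 1 + (x : ℂ) * ((phase θ - 1) / h))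
        (fun _ => (phase θ - 1) / h) := by
      refine ⟨⟨⟨intervalIntegrable_const, fun x _ => by simp; ring⟩, memLp_const _⟩, ?_⟩
      have : (h : ℂ) ≠ 0 := Complex.ofReal_ne_zero.2 hh.ne'
      change _ = phase θ * _
      simp
      field_simp
      ring
    have e1 := hweak _ _ hv
    have e2 := integral_mul_conj_deriv hh.le hρ hp hw hv
    have e3 : ∫ y in Ioo 0 h, (a y : ℂ) * g y * conj ((phase θ - 1) / h) =
        ∫ y in Ioo 0 h, w y * conj ((phase θ - 1) / h) := by
      refine integral_congr_ae ?_
      filter_upwards [hwg] with x hx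
      rw [hx]
    rw [e3, e2] at e1
    simpa [p] using e1

/-- Testing with `u` itself gives `∫ a |u'|² = z (∫ ρ |u|² + M |u(0)|²)`, and the bracket is
positive when `u ≠ 0`. -/
theorem WeakSol.exists_nonneg (hh : 0 < h) (ha : UnifPosBdd a (Ioo 0 h))
    (hρ : UnifPosBdd ρ (Ioo 0 h)) (hM : 0 ≤ M) {u g : ℝ → ℂ}
    (hu : WeakSol h a ρ θ z M 0 0 u g) (hne : ∃ x ∈ Icc 0 h, u x ≠ 0) :
    ∃ l : ℝ, 0 ≤ l ∧ z = l := by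
  have e := hu.2 u g hu.1
  obtain ⟨A, -, hA⟩ := ha.exists_bound
  obtain ⟨R, -, hR⟩ := hρ.exists_bound
  have e1 : ∫ y in Ioo 0 h, (a y : ℂ) * g y * conj (g y) =
      ((∫ y in Ioo 0 h, a y * ‖g y‖ ^ 2 : ℝ) : ℂ) := by
    rw [← integral_complex_ofReal]
    refine integral_congr_ae (.of_forall fun x => ?_)
    simp only
    rw [mul_assoc, Complex.mul_conj, Complex.normSq_eq_norm_sq]; push_cast; ring
  have e2 : ∫ y in Ioo 0 h, (ρ y : ℂ) * (z * u y + (0 : ℝ → ℂ) y) * conj (u y) =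
      z * ((∫ y in Ioo 0 h, ρ y * ‖u y‖ ^ 2 : ℝ) : ℂ) := by
    rw [← integral_complex_ofReal, ← integral_const_mul]
    refine integral_congr_ae (.of_forall fun x => ?_)
    simp only [Pi.zero_apply, add_zero]
    rw [mul_assoc, mul_assoc, Complex.mul_conj, Complex.normSq_eq_norm_sq]; push_cast; ring
  have hB : 0 < ∫ y in Ioo 0 h, ρ y * ‖u y‖ ^ 2 := by
    have hn : 0 ≤ᵐ[volume.restrict (Ioo 0 h)] fun y => ρ y * ‖u y‖ ^ 2 := by
      filter_upwards [hR] with x hx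
      have := hx.1
      positivity
    refine lt_of_le_of_ne (integral_nonneg_of_ae hn) fun h0 => ?_
    have hi : IntegrableOn (fun y => ρ y * ‖u y‖ ^ 2) (Ioo 0 h) := by
      have := (hρ.integrable_mul_mul_conj hu.1.memLp hu.1.memLp).re
      refine this.congr (.of_forall fun x => ?_)
      simp only
      rw [mul_assoc, Complex.mul_conj, Complex.normSq_eq_norm_sq]
      exact Complex.re_ofReal_mul _ _
    rw [eq_comm, setIntegral_eq_zero_iff_of_nonneg_ae hn hi] at h0
    obtain ⟨x, hx, hx0⟩ := hne
    refine hx0 (eq_zero_of_ae_eq_zero hh hu.1.1.1.continuousOn ?_ x hx)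
    filter_upwards [h0, hR] with y h1 h2
    simpa [h2.1.ne'] using h1
  have hA0 : 0 ≤ ∫ y in Ioo 0 h, a y * ‖g y‖ ^ 2 := by
    refine integral_nonneg_of_ae ?_
    filter_upwards [hA] with x hx
    have := hx.1
    positivity
  rw [e1, e2, zero_add, mul_assoc (z * M), Complex.mul_conj, Complex.normSq_eq_norm_sq] at e
  have hpos : 0 < (∫ y in Ioo 0 h, ρ y * ‖u y‖ ^ 2) + M * ‖u 0‖ ^ 2 := by positivity
  refine ⟨(∫ y in Ioo 0 h, a y * ‖g y‖ ^ 2) /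
    ((∫ y in Ioo 0 h, ρ y * ‖u y‖ ^ 2) + M * ‖u 0‖ ^ 2), by positivity, ?_⟩
  rw [Complex.ofReal_div, eq_div_iff (Complex.ofReal_ne_zero.2 hpos.ne'), e]
  push_cast
  ring

theorem exists_pair_of_det_eq_zero {p q r s : ℂ} (hdet : p * s - q * r = 0) :
    ∃ x y : ℂ, (x ≠ 0 ∨ y ≠ 0) ∧ p * x + q * y = 0 ∧ r * x + s * y = 0 := by
  by_cases h1 : p = 0 ∧ q = 0
  · by_cases h2 : r = 0 ∧ s = 0
    · exact ⟨1, 0, by simp [h1, h2]⟩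
    · refine ⟨s, -r, ?_, by simp [h1], by ring⟩
      simp only [ne_eq, neg_eq_zero]; tauto
  · refine ⟨q, -p, ?_, by ring, by linear_combination -hdet⟩
    simp only [ne_eq, neg_eq_zero]; tauto

variable {v₁ w₁ v₂ w₂ : ℝ → ℂ}

/-- The left side is the determinant of the quasi-periodicity and jump conditions in the unknowns
`u(0), w(0)`. It simplifies through the Wronskian being `1` and `|phase θ| = 1`. -/
theorem IsFund.det_eq (hf : IsFund h a ρ z v₁ w₁ v₂ w₂) (hh : 0 ≤ h) (θ : ℝ) (N : ℂ) :
    (v₁ h - phase θ) * (w₂ h * conj (phase θ) - 1) - v₂ h * (w₁ h * conj (phase θ) - N) =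
      ((2 * Real.cos θ : ℝ) : ℂ) - (v₁ h + w₂ h - N * v₂ h) := by
  have h1 := hf.wronskian (right_mem_Icc.2 hh)
  rw [← phase_add_conj]
  linear_combination conj (phase θ) * h1 - w₂ h * phase_mul_conj θ

/-- A particular solution with zero Cauchy data leaves boundary defects `b₁`, `b₂`. A homogeneous
solution corrects them, its coefficients `α`, `β` coming from Cramer's rule. -/
theorem IsFund.exists_weakSol (hf : IsFund h a ρ z v₁ w₁ v₂ w₂) (hh : 0 < h)
    (ha : UnifPosBdd a (Ioo 0 h)) (hρ : UnifPosBdd ρ (Ioo 0 h))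
    (hD : v₁ h + w₂ h - z * M * v₂ h ≠ ((2 * Real.cos θ : ℝ) : ℂ)) {F : ℝ → ℂ} (d : ℂ)
    (hF : MemLp F 2 (volume.restrict (Ioo 0 h))) :
    ∃ u g, WeakSol h a ρ θ z M F d u g := by
  obtain ⟨p, q, hs, hp0, hq0⟩ := exists_isSol hh.le ha hρ z hF 0 0
  have hdet := hf.det_eq hh.le θ (z * M)
  set D := ((2 * Real.cos θ : ℝ) : ℂ) - (v₁ h + w₂ h - z * M * v₂ h) with hDdef
  have hD0 : D ≠ 0 := sub_ne_zero.2 hD.symm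
  set e := phase θ
  let b₁ := -p h
  let b₂ := d - q h * conj e
  let α := (b₁ * (w₂ h * conj e - 1) - v₂ h * b₂) / D
  let β := ((v₁ h - e) * b₂ - (w₁ h * conj e - z * M) * b₁) / D
  have E1 : (v₁ h - e) * α + v₂ h * β = b₁ := by
    simp only [α, β]; field_simp; linear_combination b₁ * hdet
  have E2 : (w₁ h * conj e - z * M) * α + (w₂ h * conj e - 1) * β = b₂ := by
    simp only [α, β]; field_simp; linear_combination b₂ * hdet
  have hsol := hs.add (hf.isSol_combination hh.le α β) hh.le
  rw [add_zero] at hsol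
  refine ⟨_, _, hsol.weakSol hh.le ha hρ hF ?_ ?_⟩
  · simp only [Pi.add_apply, Pi.smul_apply, smul_eq_mul, hp0, hf.v₁_zero, hf.v₂_zero]
    linear_combination E1
  · simp only [Pi.add_apply, Pi.smul_apply, smul_eq_mul, hp0, hf.v₁_zero, hf.v₂_zero, hq0,
      hf.w₁_zero, hf.w₂_zero]
    linear_combination E2

/-- A kernel vector of the boundary matrix is exactly the Cauchy data of a homogeneous solution, so
the dispersion relation is the vanishing of the determinant. -/
theorem IsFund.noEigen_iff (hf : IsFund h a ρ z v₁ w₁ v₂ w₂) (hh : 0 < h)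
    (ha : UnifPosBdd a (Ioo 0 h)) (hρ : UnifPosBdd ρ (Ioo 0 h)) :
    NoEigen h a ρ θ z M ↔ v₁ h + w₂ h - z * M * v₂ h ≠ ((2 * Real.cos θ : ℝ) : ℂ) := by
  have hdet := hf.det_eq hh.le θ (z * M)
  have hhm := right_mem_Icc.2 hh.le
  constructor
  · intro hno hD
    rw [hD, sub_self] at hdet
    obtain ⟨α, β, hne, E1, E2⟩ := exists_pair_of_det_eq_zero hdet
    have hsol := hf.isSol_combination hh.le α β
    have hw := hsol.weakSol (θ := θ) (M := M) (d := 0) hh.le ha hρ MemLp.zero (by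
      simp only [Pi.add_apply, Pi.smul_apply, smul_eq_mul, hf.v₁_zero, hf.v₂_zero]
      linear_combination E1) (by
      simp only [Pi.add_apply, Pi.smul_apply, smul_eq_mul, hf.v₁_zero, hf.v₂_zero,
        hf.w₁_zero, hf.w₂_zero]
      linear_combination E2)
    have hz := hno _ _ hw
    have hz0 := hz 0 (left_mem_Icc.2 hh.le)
    have hw0 := hsol.eq_zero_of_forall_eq_zero hh ha hz
    simp only [Pi.add_apply, Pi.smul_apply, smul_eq_mul, hf.v₁_zero, hf.v₂_zero,
        hf.w₁_zero, hf.w₂_zero, mul_one, mul_zero, add_zero, zero_add] at hz0 hw0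
    tauto
  · intro hD u g hu x hx
    obtain ⟨w, hs, hj⟩ := hu.exists_isSol hh ha hρ MemLp.zero
    have hper := hu.1.apply_end
    obtain ⟨c1, c2⟩ := hf.eq_combination hs hhm
    rw [c1] at hper
    rw [c2] at hj
    have hD0 := sub_ne_zero.2 hD.symm
    rw [← hdet] at hD0
    have hα : u 0 = 0 := by
      refine (mul_eq_zero.1 (?_ : _ * u 0 = 0)).resolve_left hD0
      linear_combination (w₂ h * conj (phase θ) - 1) * hper - v₂ h * hj
    have hβ : w 0 = 0 := by
      refine (mul_eq_zero.1 (?_ : _ * w 0 = 0)).resolve_left hD0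
      linear_combination (v₁ h - phase θ) * hj - (w₁ h * conj (phase θ) - z * M) * hper
    rw [(hf.eq_combination hs hx).1, hα, hβ]
    ring

/-- Cramer's rule for the first unknown with right-hand side `(0, 1)`: the diagonal value of the
Green function at the end point, stated without division. -/
theorem IsFund.weakSol_apply_zero (hf : IsFund h a ρ z v₁ w₁ v₂ w₂) (hh : 0 < h)
    (ha : UnifPosBdd a (Ioo 0 h)) (hρ : UnifPosBdd ρ (Ioo 0 h)) {u g : ℝ → ℂ}
    (hu : WeakSol h a ρ θ z 0 0 1 u g) :
    u 0 * (v₁ h + w₂ h - ((2 * Real.cos θ : ℝ) : ℂ)) = v₂ h := by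
  obtain ⟨w, hs, hj⟩ := hu.exists_isSol hh ha hρ MemLp.zero
  have hper := hu.1.apply_end
  obtain ⟨c1, c2⟩ := hf.eq_combination hs (right_mem_Icc.2 hh.le)
  rw [c1] at hper
  rw [c2, Complex.ofReal_zero] at hj
  have hdet := hf.det_eq hh.le θ 0
  linear_combination u 0 * hdet - (w₂ h * conj (phase θ) - 1) * hper + v₂ h * hj

theorem NoEigen.exists_weakSol (hno : NoEigen h a ρ θ z M) (hh : 0 < h)
    (ha : UnifPosBdd a (Ioo 0 h)) (hρ : UnifPosBdd ρ (Ioo 0 h)) {F : ℝ → ℂ} (d : ℂ)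
    (hF : MemLp F 2 (volume.restrict (Ioo 0 h))) :
    ∃ u g, WeakSol h a ρ θ z M F d u g := by
  obtain ⟨v₁, w₁, v₂, w₂, hf⟩ := exists_isFund hh.le ha hρ z
  exact hf.exists_weakSol hh ha hρ ((hf.noEigen_iff hh ha hρ).1 hno) d hF

end Weak

/-- An everywhere defined operator on a Hilbert space that has an adjoint is linear and bounded. -/
theorem exists_clm_of_adjoint {H : Type*} [NormedAddCommGroup H] [InnerProductSpace ℂ H]
    [CompleteSpace H] (R S : H → H) (hRS : ∀ f g, ⟪R f, g⟫_ℂ = ⟪f, S g⟫_ℂ) :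
    ∃ T : H →L[ℂ] H, ∀ f, T f = R f := by
  let L : H →ₗ[ℂ] H :=
    { toFun := R
      map_add' := fun x y => ext_inner_right ℂ fun v => by
        rw [inner_add_left, hRS, hRS, hRS, inner_add_left]
      map_smul' := fun c x => ext_inner_right ℂ fun v => by
        rw [RingHom.id_apply, inner_smul_left, hRS, hRS, inner_smul_left] }
  -- Closed graph theorem: pairing with `v` moves the operator onto `S v`, which identifies the
  -- limit weakly.
  have hL : Continuous L := by
    refine L.continuous_of_seq_closed_graph fun u x y hu hTu => ext_inner_right ℂ fun v => ?_
    refine tendsto_nhds_unique (hTu.inner tendsto_const_nhds) ?_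
    have : ∀ f, ⟪L f, v⟫_ℂ = ⟪f, S v⟫_ℂ := fun f => hRS f v
    simp only [Function.comp_apply, this]
    exact hu.inner tendsto_const_nhds
  exact ⟨⟨L, hL⟩, fun _ => rfl⟩

/-! ### Weighted `L²` spaces versus Lebesgue measure. -/

section WeightedMeasure

/-- The measure `ρ dx` on `s`. -/
def wMeasure (ρ : ℝ → ℝ) (s : Set ℝ) : Measure ℝ :=
  (volume.restrict s).withDensity fun y => ENNReal.ofReal (ρ y)

variable {ρ : ℝ → ℝ} {s : Set ℝ}

theorem UnifPosBdd.ae_wMeasure (hρ : UnifPosBdd ρ s) :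
    ae (wMeasure ρ s) = ae (volume.restrict s) := by
  refine le_antisymm (withDensity_absolutelyContinuous _ _).ae_le
    (withDensity_absolutelyContinuous' hρ.1.ennreal_ofReal ?_).ae_le
  obtain ⟨C, -, hb⟩ := hρ.exists_bound
  filter_upwards [hb] with x hx
  simpa using hx.1

theorem UnifPosBdd.integral_wMeasure (hρ : UnifPosBdd ρ s) (f : ℝ → ℂ) :
    ∫ x, f x ∂wMeasure ρ s = ∫ x in s, (ρ x : ℂ) * f x := by
  rw [wMeasure, integral_withDensity_eq_integral_toReal_smul₀ hρ.1.ennreal_ofReal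
    (.of_forall fun x => ENNReal.ofReal_lt_top)]
  obtain ⟨C, -, hb⟩ := hρ.exists_bound
  refine integral_congr_ae ?_
  filter_upwards [hb] with x hx
  rw [ENNReal.toReal_ofReal hx.1.le, Complex.real_smul]

theorem UnifPosBdd.memLp_wMeasure (hρ : UnifPosBdd ρ s) {p : ENNReal} {f : ℝ → ℂ} :
    MemLp f p (wMeasure ρ s) ↔ MemLp f p (volume.restrict s) := by
  obtain ⟨-, c, C, hc, hb⟩ := hρ
  have h1 : wMeasure ρ s ≤ ENNReal.ofReal C • volume.restrict s := by
    rw [← withDensity_const]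
    exact withDensity_mono (hb.mono fun x hx => ENNReal.ofReal_le_ofReal hx.2)
  have h2 : volume.restrict s ≤ (ENNReal.ofReal c)⁻¹ • wMeasure ρ s := by
    have h3 : ENNReal.ofReal c • volume.restrict s ≤ wMeasure ρ s := by
      rw [← withDensity_const]
      exact withDensity_mono (hb.mono fun x hx => ENNReal.ofReal_le_ofReal hx.1)
    calc volume.restrict s = (ENNReal.ofReal c)⁻¹ • ENNReal.ofReal c • volume.restrict s := by
          rw [smul_smul, ENNReal.inv_mul_cancel (by simpa using hc) ENNReal.ofReal_ne_top,
            one_smul]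
      _ ≤ _ := by gcongr
  exact ⟨fun h => h.of_measure_le_smul (by simpa using hc) h2,
    fun h => h.of_measure_le_smul ENNReal.ofReal_ne_top h1⟩

theorem UnifPosBdd.inner_wMeasure (hρ : UnifPosBdd ρ s) (f g : Lp ℂ 2 (wMeasure ρ s)) :
    ⟪f, g⟫_ℂ = ∫ x in s, (ρ x : ℂ) * g x * conj (f x) := by
  rw [L2.inner_def, hρ.integral_wMeasure]
  refine integral_congr_ae (.of_forall fun x => ?_)
  simp only [RCLike.inner_apply, mul_assoc]

theorem UnifPosBdd.memLp_coe (hρ : UnifPosBdd ρ s) (f : Lp ℂ 2 (wMeasure ρ s)) :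
    MemLp f 2 (volume.restrict s) := hρ.memLp_wMeasure.1 (Lp.memLp f)

end WeightedMeasure

/-! ### Linearity, uniqueness and conjugation for the weak problem. -/

section Forms

variable {h : ℝ} {a ρ : ℝ → ℝ} {θ : ℝ} {z : ℂ} {M : ℝ}

theorem conj_form (s : Set ℝ) (a : ℝ → ℝ) (f g : ℝ → ℂ) :
    conj (∫ y in s, (a y : ℂ) * f y * conj (g y)) = ∫ y in s, (a y : ℂ) * g y * conj (f y) := by
  rw [← integral_conj]
  refine integral_congr_ae (.of_forall fun x => ?_)
  simp only [map_mul, Complex.conj_ofReal, Complex.conj_conj]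
  ring

theorem H1QuasiPer.add {u g v k : ℝ → ℂ} (hu : H1QuasiPer h θ u g) (hv : H1QuasiPer h θ v k) :
    H1QuasiPer h θ (u + v) (g + k) := by
  refine ⟨⟨hu.1.1.add hv.1.1, hu.1.2.add hv.1.2⟩, ?_⟩
  simp only [Pi.add_apply]
  rw [hu.2, hv.2, mul_add]

theorem H1QuasiPer.smul {u g : ℝ → ℂ} (hu : H1QuasiPer h θ u g) (c : ℂ) :
    H1QuasiPer h θ (c • u) (c • g) := by
  refine ⟨⟨hu.1.1.const_mul c, hu.1.2.const_smul c⟩, ?_⟩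
  simp only [Pi.smul_apply, smul_eq_mul]
  rw [hu.2]
  ring

theorem H1QuasiPer.sub {u g v k : ℝ → ℂ} (hu : H1QuasiPer h θ u g) (hv : H1QuasiPer h θ v k) :
    H1QuasiPer h θ (u - v) (g - k) := by
  simpa [sub_eq_add_neg] using hu.add (hv.smul (-1))

theorem WeakSol.sub (ha : UnifPosBdd a (Ioo 0 h)) (hρ : UnifPosBdd ρ (Ioo 0 h))
    {F G u g v k : ℝ → ℂ} {d e : ℂ} (hF : MemLp F 2 (volume.restrict (Ioo 0 h)))
    (hG : MemLp G 2 (volume.restrict (Ioo 0 h))) (hu : WeakSol h a ρ θ z M F d u g)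
    (hv : WeakSol h a ρ θ z M G e v k) :
    WeakSol h a ρ θ z M (F - G) (d - e) (u - v) (g - k) := by
  refine ⟨hu.1.sub hv.1, fun p q hp => ?_⟩
  have e1 := hu.2 p q hp
  have e2 := hv.2 p q hp
  have i1 := ha.integrable_mul_mul_conj hu.1.1.2 hp.1.2
  have i2 := ha.integrable_mul_mul_conj hv.1.1.2 hp.1.2
  have i3 := hρ.integrable_mul_mul_conj ((hu.1.memLp.const_mul z).add hF) hp.memLp
  have i4 := hρ.integrable_mul_mul_conj ((hv.1.memLp.const_mul z).add hG) hp.memLp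
  simp only [Pi.add_apply] at i3 i4
  have s1 : ∫ y in Ioo 0 h, (a y : ℂ) * (g - k) y * conj (q y) =
      (∫ y in Ioo 0 h, (a y : ℂ) * g y * conj (q y)) -
        ∫ y in Ioo 0 h, (a y : ℂ) * k y * conj (q y) := by
    rw [← integral_sub i1 i2]
    refine integral_congr_ae (.of_forall fun x => ?_)
    simp only [Pi.sub_apply]; ring
  have s2 : ∫ y in Ioo 0 h, (ρ y : ℂ) * (z * (u - v) y + (F - G) y) * conj (p y) =
      (∫ y in Ioo 0 h, (ρ y : ℂ) * (z * u y + F y) * conj (p y)) -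
        ∫ y in Ioo 0 h, (ρ y : ℂ) * (z * v y + G y) * conj (p y) := by
    rw [← integral_sub i3 i4]
    refine integral_congr_ae (.of_forall fun x => ?_)
    simp only [Pi.sub_apply]; ring
  rw [s1, s2, e1, e2]
  simp only [Pi.sub_apply]; ring

theorem NoEigen.weakSol_unique (hno : NoEigen h a ρ θ z M) (ha : UnifPosBdd a (Ioo 0 h))
    (hρ : UnifPosBdd ρ (Ioo 0 h)) {F u g v k : ℝ → ℂ} {d : ℂ}
    (hF : MemLp F 2 (volume.restrict (Ioo 0 h))) (hu : WeakSol h a ρ θ z M F d u g)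
    (hv : WeakSol h a ρ θ z M F d v k) {x : ℝ} (hx : x ∈ Icc 0 h) : u x = v x := by
  have := hu.sub ha hρ hF hF hv
  rw [sub_self, sub_self] at this
  exact sub_eq_zero.1 (hno _ _ this x hx)

theorem NoEigen.of_not_nonneg (hh : 0 < h) (ha : UnifPosBdd a (Ioo 0 h))
    (hρ : UnifPosBdd ρ (Ioo 0 h)) (hM : 0 ≤ M) (hz : ¬ ∃ l : ℝ, 0 ≤ l ∧ z = l) :
    NoEigen h a ρ θ z M := by
  intro u g hu
  by_contra! hne
  exact hz (hu.exists_nonneg hh ha hρ hM hne)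

/-- A non-negative real number is its own conjugate, and every other value is excluded by positivity
of the form. This makes the solution operator at `conj z` available as the adjoint of the one at
`z`. -/
theorem NoEigen.conj (hno : NoEigen h a ρ θ z M) (hh : 0 < h) (ha : UnifPosBdd a (Ioo 0 h))
    (hρ : UnifPosBdd ρ (Ioo 0 h)) (hM : 0 ≤ M) : NoEigen h a ρ θ (conj z) M := by
  by_cases hz : ∃ l : ℝ, 0 ≤ l ∧ conj z = l
  · obtain ⟨l, -, hl⟩ := hz
    have : z = l := by rw [← Complex.conj_conj z, hl, Complex.conj_ofReal]
    rwa [this, Complex.conj_ofReal, ← this]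
  · exact .of_not_nonneg hh ha hρ hM hz

end Forms

/-! ### Reduction of `A_θ` to the weak problem on `(0, h)`. -/

section Cell

variable {h : ℝ} {a₀ ρ₀ ρ₁ : ℝ → ℝ} {θ : ℝ} {z : ℂ}

theorem unifPosBdd_cellDensity (h_pos : 0 < h) (h_lt : h < 1) (hρ₀ : UnifPosBdd ρ₀ (Ioo 0 h))
    (hρ₁ : UnifPosBdd ρ₁ (Ioo h 1)) : UnifPosBdd (cellDensity h ρ₀ ρ₁) (Ioo 0 1) := by
  have e0 : ∀ x ∈ Ioo 0 h, cellDensity h ρ₀ ρ₁ x = ρ₀ x := fun x hx => if_pos hx.2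
  have e1 : ∀ x ∈ Ioo h 1, cellDensity h ρ₀ ρ₁ x = ρ₁ x := fun x hx => if_neg hx.1.not_gt
  have hset : (volume.restrict (Ioo 0 1) : Measure ℝ) =
      volume.restrict (Ioo 0 h ∪ Ioo h 1) := by
    have : (Ioo 0 h ∪ Ioo h 1 : Set ℝ) =ᵐ[volume] (Ioo 0 1 : Set ℝ) := by
      have : (Ioo 0 1 : Set ℝ) = Ioo 0 h ∪ Ico h 1 := (Ioo_union_Ico_eq_Ioo h_pos h_lt.le).symm
      rw [this]
      exact (ae_eq_refl _).union Ioo_ae_eq_Ico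
    exact (Measure.restrict_congr_set this).symm
  obtain ⟨m0, c0, C0, hc0, hb0⟩ := hρ₀
  obtain ⟨m1, c1, C1, hc1, hb1⟩ := hρ₁
  unfold UnifPosBdd
  rw [hset]
  refine ⟨?_, min c0 c1, max C0 C1, lt_min hc0 hc1, ?_⟩
  · rw [aemeasurable_union_iff]
    exact ⟨m0.congr
        ((ae_restrict_iff' measurableSet_Ioo).2 (.of_forall fun x hx => (e0 x hx).symm)),
      m1.congr ((ae_restrict_iff' measurableSet_Ioo).2 (.of_forall fun x hx => (e1 x hx).symm))⟩
  · rw [ae_restrict_union_iff]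
    constructor
    · filter_upwards [hb0, ae_restrict_mem measurableSet_Ioo] with x h1 h2
      rw [e0 x h2]
      exact ⟨(min_le_left _ _).trans h1.1, h1.2.trans (le_max_left _ _)⟩
    · filter_upwards [hb1, ae_restrict_mem measurableSet_Ioo] with x h1 h2
      rw [e1 x h2]
      exact ⟨(min_le_right _ _).trans h1.1, h1.2.trans (le_max_right _ _)⟩

theorem setIntegral_cell (h_pos : 0 < h) (h_lt : h < 1) {f : ℝ → ℂ}
    (hf : IntegrableOn f (Ioo 0 1)) :
    ∫ x in Ioo 0 1, f x = (∫ x in Ioo 0 h, f x) + ∫ x in Ioo h 1, f x := by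
  rw [← Ioo_union_Ico_eq_Ioo h_pos h_lt.le, setIntegral_union _ measurableSet_Ico
    (hf.mono_set (Ioo_subset_Ioo_right h_lt.le))
    (hf.mono_set fun x hx => ⟨h_pos.trans_le hx.1, hx.2⟩), integral_Ico_eq_integral_Ioo]
  exact Set.disjoint_left.2 fun x h1 h2 => h1.2.not_ge h2.1

/-- Extension of a function on `[0, h]` by a constant. -/
def constExt (h : ℝ) (u : ℝ → ℂ) (x : ℝ) : ℂ := u (min x h)

theorem constExt_of_le {u : ℝ → ℂ} {x : ℝ} (hx : x ≤ h) : constExt h u x = u x := by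
  rw [constExt, min_eq_left hx]

theorem constExt_of_ge {u : ℝ → ℂ} {x : ℝ} (hx : h ≤ x) : constExt h u x = u h := by
  rw [constExt, min_eq_right hx]

/-- The constant continuation carries the value `u(h) = e^{iθ} u(0)` to the point `1`. Together with
`InV.h1QuasiPer` this identifies `V_θ` with the quasi-periodic space on `(0, h)`. -/
theorem H1QuasiPer.inV (h_pos : 0 < h) (h_lt : h < 1) {u g : ℝ → ℂ} (hu : H1QuasiPer h θ u g) :
    InV h θ (constExt h u) (indicator (Ioo 0 h) g) := by
  have hi : Integrable (indicator (Ioo 0 h) g) :=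
    (hu.1.1.integrableOn h_pos.le).integrable_indicator measurableSet_Ioo
  have hint : ∀ x ∈ Icc 0 h, ∫ t in (0 : ℝ)..x, indicator (Ioo 0 h) g t =
      ∫ t in (0 : ℝ)..x, g t := by
    intro x hx
    rw [intervalIntegral.integral_of_le hx.1, intervalIntegral.integral_of_le hx.1,
      integral_Ioc_eq_integral_Ioo, integral_Ioc_eq_integral_Ioo]
    exact setIntegral_congr_fun measurableSet_Ioo fun t ht =>
      indicator_of_mem (s := Ioo 0 h) ⟨ht.1, ht.2.trans_le hx.2⟩ g
  refine ⟨⟨⟨⟨hi.intervalIntegrable, fun x hx => ?_⟩, ?_⟩, ?_⟩, ?_⟩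
  · rw [constExt_of_le h_pos.le]
    rcases le_total x h with hxh | hxh
    · rw [constExt_of_le hxh, hint x ⟨hx.1, hxh⟩, hu.1.1.2 x ⟨hx.1, hxh⟩]
    · rw [constExt_of_ge hxh, ← intervalIntegral.integral_add_adjacent_intervals (b := h)
        hi.intervalIntegrable hi.intervalIntegrable, hint h (right_mem_Icc.2 h_pos.le),
        hu.1.1.2 h (right_mem_Icc.2 h_pos.le)]
      have : ∫ t in h..x, indicator (Ioo 0 h) g t = 0 := by
        rw [intervalIntegral.integral_of_le hxh]
        refine setIntegral_eq_zero_of_forall_eq_zero fun t ht => indicator_of_notMem ?_ g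
        exact fun h2 => h2.2.not_gt ht.1
      rw [this, add_zero]
  · exact ((memLp_indicator_iff_restrict measurableSet_Ioo).2 hu.1.2).mono_measure
      Measure.restrict_le_self
  · rw [constExt_of_ge h_lt.le, constExt_of_le h_pos.le]
    exact hu.2
  · filter_upwards [ae_restrict_mem measurableSet_Ioo] with x hx
    exact indicator_of_notMem (fun h2 => h2.2.not_gt hx.1) g

theorem InV.eq_of_ge (h_pos : 0 < h) (h_lt : h < 1) {u g : ℝ → ℂ} (hu : InV h θ u g) {x : ℝ}
    (hx : x ∈ Icc h 1) : u x = u h := by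
  have hh : h ∈ Icc (0 : ℝ) 1 := ⟨h_pos.le, h_lt.le⟩
  rw [← sub_eq_zero, hu.1.1.1.sub_eq_integral hh ⟨h_pos.le.trans hx.1, hx.2⟩,
    intervalIntegral.integral_of_le hx.1, integral_Ioc_eq_integral_Ioo]
  refine integral_eq_zero_of_ae ?_
  exact ae_restrict_of_ae_restrict_of_subset (Ioo_subset_Ioo_right hx.2) hu.2

theorem InV.h1QuasiPer (h_pos : 0 < h) (h_lt : h < 1) {u g : ℝ → ℂ} (hu : InV h θ u g) :
    H1QuasiPer h θ u g := by
  refine ⟨⟨hu.1.1.1.mono h_pos.le h_lt.le, hu.1.1.2.mono_measure ?_⟩, ?_⟩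
  · exact Measure.restrict_mono (Ioo_subset_Ioo_right h_lt.le) le_rfl
  · rw [← hu.eq_of_ge h_pos h_lt (right_mem_Icc.2 h_lt.le)]
    exact hu.1.2

theorem InV.memLp {u g : ℝ → ℂ} (hu : InV h θ u g) : MemLp u 2 (volume.restrict (Ioo 0 1)) :=
  hu.1.memLp

/-- On `Y₁` the test function is the constant `phase θ * v 0`, so the stiff part contributes a
multiple of `conj (v 0)`. -/
theorem InV.cell_integral (h_pos : 0 < h) (h_lt : h < 1) (hρ₀ : UnifPosBdd ρ₀ (Ioo 0 h))
    (hρ₁ : UnifPosBdd ρ₁ (Ioo h 1)) {f v k : ℝ → ℂ} (hf : MemLp f 2 (volume.restrict (Ioo 0 1)))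
    (hv : InV h θ v k) :
    ∫ y in Ioo 0 1, (cellDensity h ρ₀ ρ₁ y : ℂ) * f y * conj (v y) =
      (∫ y in Ioo 0 h, (ρ₀ y : ℂ) * f y * conj (v y)) +
        (conj (phase θ) * ∫ y in Ioo h 1, (ρ₁ y : ℂ) * f y) * conj (v 0) := by
  rw [setIntegral_cell h_pos h_lt
    ((unifPosBdd_cellDensity h_pos h_lt hρ₀ hρ₁).integrable_mul_mul_conj hf hv.memLp)]
  congr 1
  · refine setIntegral_congr_fun measurableSet_Ioo fun x hx => ?_
    simp only [cellDensity, if_pos hx.2]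
  · rw [mul_right_comm, ← map_mul, ← (hv.h1QuasiPer h_pos h_lt).apply_end, mul_comm,
      ← integral_mul_const]
    refine setIntegral_congr_fun measurableSet_Ioo fun x hx => ?_
    simp only [cellDensity, if_neg hx.1.not_gt]
    rw [hv.eq_of_ge h_pos h_lt (Ioo_subset_Icc_self hx)]

theorem constExt_ae (h_pos : 0 < h) (h_lt : h < 1) {u g : ℝ → ℂ} (hu : InV h θ u g) :
    ∀ x ∈ Ioo (0 : ℝ) 1, constExt h u x = u x := by
  intro x hx
  rcases le_total x h with hxh | hxh
  · exact constExt_of_le hxh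
  · rw [constExt_of_ge hxh, hu.eq_of_ge h_pos h_lt ⟨hxh, hx.2.le⟩]

theorem memLp_mono_left {f : ℝ → ℂ} (h_lt : h < 1) (hf : MemLp f 2 (volume.restrict (Ioo 0 1))) :
    MemLp f 2 (volume.restrict (Ioo 0 h)) :=
  hf.mono_measure (Measure.restrict_mono (Ioo_subset_Ioo_right h_lt.le) le_rfl)

theorem memLp_mono_right {f : ℝ → ℂ} (h_pos : 0 < h)
    (hf : MemLp f 2 (volume.restrict (Ioo 0 1))) :
    MemLp f 2 (volume.restrict (Ioo h 1)) :=
  hf.mono_measure (Measure.restrict_mono (Ioo_subset_Ioo_left h_pos.le) le_rfl)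

/-- `(A_θ - z) u = f` in terms of the weak problem on `(0, h)`. -/
theorem limitOp_iff (h_pos : 0 < h) (h_lt : h < 1) (hρ₀ : UnifPosBdd ρ₀ (Ioo 0 h))
    (hρ₁ : UnifPosBdd ρ₁ (Ioo h 1)) (u f : VClosure h ρ₀ ρ₁ θ) :
    LimitOp h a₀ ρ₀ ρ₁ θ u (f + z • u) ↔ ∃ w g,
      WeakSol h a₀ ρ₀ θ z (∫ y in Ioo h 1, ρ₁ y) (f : CellL2 h ρ₀ ρ₁)
        (conj (phase θ) * ∫ y in Ioo h 1, (ρ₁ y : ℂ) * (f : CellL2 h ρ₀ ρ₁) y) w g ∧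
      (u : CellL2 h ρ₀ ρ₁) =ᵐ[volume.restrict (Ioo 0 1)] constExt h w := by
  have hcd := unifPosBdd_cellDensity h_pos h_lt hρ₀ hρ₁
  have hae : ae (cellMeasure h ρ₀ ρ₁) = ae (volume.restrict (Ioo 0 1)) := hcd.ae_wMeasure
  have hfm : MemLp (f : CellL2 h ρ₀ ρ₁) 2 (volume.restrict (Ioo 0 1)) := hcd.memLp_coe _
  have hfu : MemLp ((f + z • u : VClosure h ρ₀ ρ₁ θ) : CellL2 h ρ₀ ρ₁) 2
    (volume.restrict (Ioo 0 1)) := hcd.memLp_coe _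
  have hco : (((f + z • u : VClosure h ρ₀ ρ₁ θ) : CellL2 h ρ₀ ρ₁) : ℝ → ℂ)
      =ᵐ[volume.restrict (Ioo 0 1)] fun y => (f : CellL2 h ρ₀ ρ₁) y +
        z * (u : CellL2 h ρ₀ ρ₁) y := by
    have h1 := Lp.coeFn_add (f : CellL2 h ρ₀ ρ₁) (z • (u : CellL2 h ρ₀ ρ₁))
    have h2 := Lp.coeFn_smul z (u : CellL2 h ρ₀ ρ₁)
    unfold EventuallyEq at h1 h2 ⊢
    rw [hae] at h1 h2
    filter_upwards [h1, h2] with x h3 h4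
    rw [Pi.add_apply, h4, Pi.smul_apply, smul_eq_mul] at h3
    exact h3
  -- Since `w` equals `phase θ * w 0` on `Y₁`, the two phases cancel in the `z`-term and leave the
  -- point mass `z M w(0)`.
  have key : ∀ w g, InV h θ w g →
      (u : CellL2 h ρ₀ ρ₁) =ᵐ[volume.restrict (Ioo 0 1)] w → ∀ v k, InV h θ v k →
      ∫ y in Ioo 0 1, (cellDensity h ρ₀ ρ₁ y : ℂ) *
          ((f + z • u : VClosure h ρ₀ ρ₁ θ) : CellL2 h ρ₀ ρ₁) y * conj (v y) =
        (∫ y in Ioo 0 h, (ρ₀ y : ℂ) * (z * w y + (f : CellL2 h ρ₀ ρ₁) y) * conj (v y)) +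
        ((conj (phase θ) * ∫ y in Ioo h 1, (ρ₁ y : ℂ) * (f : CellL2 h ρ₀ ρ₁) y) +
          z * ((∫ y in Ioo h 1, ρ₁ y : ℝ) : ℂ) * w 0) * conj (v 0) := by
    intro w g hw huw v k hv
    rw [hv.cell_integral h_pos h_lt hρ₀ hρ₁ hfu]
    have hc2 : (((f + z • u : VClosure h ρ₀ ρ₁ θ) : CellL2 h ρ₀ ρ₁) : ℝ → ℂ)
      =ᵐ[volume.restrict (Ioo 0 1)] fun y => z * w y + (f : CellL2 h ρ₀ ρ₁) y := by
      filter_upwards [hco, huw] with x h1 h2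
      rw [h1, h2, add_comm]
    congr 1
    · refine integral_congr_ae ?_
      filter_upwards [ae_restrict_of_ae_restrict_of_subset (Ioo_subset_Ioo_right h_lt.le) hc2]
        with x hx
      rw [hx]
    · congr 1
      have : ∫ y in Ioo h 1, (ρ₁ y : ℂ) *
          ((f + z • u : VClosure h ρ₀ ρ₁ θ) : CellL2 h ρ₀ ρ₁) y =
          (∫ y in Ioo h 1, (ρ₁ y : ℂ) * (f : CellL2 h ρ₀ ρ₁) y) +
            ((∫ y in Ioo h 1, ρ₁ y : ℝ) : ℂ) * (z * w h) := by
        have i1 : IntegrableOn (fun y => (ρ₁ y : ℂ) * (f : CellL2 h ρ₀ ρ₁) y) (Ioo h 1) :=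
          integrableOn_of_memLp_two (hρ₁.memLp_mul (memLp_mono_right h_pos hfm))
        have i2 : IntegrableOn (fun y => (ρ₁ y : ℂ) * (z * w h)) (Ioo h 1) :=
          integrableOn_of_memLp_two (hρ₁.memLp_mul (memLp_const _))
        rw [← integral_complex_ofReal, ← integral_mul_const, ← integral_add i1 i2]
        refine integral_congr_ae ?_
        filter_upwards [ae_restrict_of_ae_restrict_of_subset (Ioo_subset_Ioo_left h_pos.le) hc2,
          ae_restrict_mem measurableSet_Ioo] with x h1 h2
        rw [h1, hw.eq_of_ge h_pos h_lt (Ioo_subset_Icc_self h2)]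
        ring
      rw [this, (hw.h1QuasiPer h_pos h_lt).apply_end]
      linear_combination z * ((∫ y in Ioo h 1, ρ₁ y : ℝ) : ℂ) * w 0 * phase_mul_conj θ
  constructor
  · rintro ⟨w, g, hw, huw, hall⟩
    unfold EventuallyEq at huw
    rw [hae] at huw
    refine ⟨w, g, ⟨hw.h1QuasiPer h_pos h_lt, fun v k hv => ?_⟩, ?_⟩
    · have h1 := hall _ _ (hv.inV h_pos h_lt)
      rw [key w g hw huw _ _ (hv.inV h_pos h_lt), constExt_of_le h_pos.le] at h1
      have e1 : ∫ y in Ioo 0 h, (a₀ y : ℂ) * g y * conj (indicator (Ioo 0 h) k y) =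
          ∫ y in Ioo 0 h, (a₀ y : ℂ) * g y * conj (k y) :=
        setIntegral_congr_fun measurableSet_Ioo fun x hx => by simp only [indicator_of_mem hx]
      have e2 : ∫ y in Ioo 0 h, (ρ₀ y : ℂ) * (z * w y + (f : CellL2 h ρ₀ ρ₁) y) *
            conj (constExt h v y) =
          ∫ y in Ioo 0 h, (ρ₀ y : ℂ) * (z * w y + (f : CellL2 h ρ₀ ρ₁) y) * conj (v y) :=
        setIntegral_congr_fun measurableSet_Ioo fun x hx => by
          simp only [constExt_of_le hx.2.le]
      rwa [e1, e2] at h1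
    · filter_upwards [huw, ae_restrict_mem measurableSet_Ioo] with x h1 h2
      rw [constExt_ae h_pos h_lt hw x h2, h1]
  · rintro ⟨w, g, hw, huw⟩
    have hwV := hw.1.inV h_pos h_lt
    refine ⟨_, _, hwV, ?_, fun v k hv => ?_⟩
    · unfold EventuallyEq
      rw [hae]
      exact huw
    · rw [key _ _ hwV huw v k hv, constExt_of_le h_pos.le]
      have e1 : ∫ y in Ioo 0 h, (a₀ y : ℂ) * indicator (Ioo 0 h) g y * conj (k y) =
          ∫ y in Ioo 0 h, (a₀ y : ℂ) * g y * conj (k y) :=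
        setIntegral_congr_fun measurableSet_Ioo fun x hx => by simp only [indicator_of_mem hx]
      have e2 : ∫ y in Ioo 0 h, (ρ₀ y : ℂ) * (z * constExt h w y + (f : CellL2 h ρ₀ ρ₁) y) *
            conj (v y) =
          ∫ y in Ioo 0 h, (ρ₀ y : ℂ) * (z * w y + (f : CellL2 h ρ₀ ρ₁) y) * conj (v y) :=
        setIntegral_congr_fun measurableSet_Ioo fun x hx => by
          simp only [constExt_of_le hx.2.le]
      rw [e1, e2]
      exact hw.2 v k (hv.h1QuasiPer h_pos h_lt)

theorem H1QuasiPer.exists_mem_VClosure (h_pos : 0 < h) (h_lt : h < 1)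
    (hρ₀ : UnifPosBdd ρ₀ (Ioo 0 h)) (hρ₁ : UnifPosBdd ρ₁ (Ioo h 1)) {w g : ℝ → ℂ}
    (hw : H1QuasiPer h θ w g) :
    ∃ u : VClosure h ρ₀ ρ₁ θ,
      (u : CellL2 h ρ₀ ρ₁) =ᵐ[volume.restrict (Ioo 0 1)] constExt h w := by
  have hcd := unifPosBdd_cellDensity h_pos h_lt hρ₀ hρ₁
  have hae : ae (cellMeasure h ρ₀ ρ₁) = ae (volume.restrict (Ioo 0 1)) := hcd.ae_wMeasure
  have hwV := hw.inV h_pos h_lt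
  have hm : MemLp (constExt h w) 2 (cellMeasure h ρ₀ ρ₁) := hcd.memLp_wMeasure.2 hwV.memLp
  refine ⟨⟨hm.toLp, Submodule.le_topologicalClosure _ ⟨_, _, hwV, hm.coeFn_toLp⟩⟩, ?_⟩
  have := hm.coeFn_toLp
  unfold EventuallyEq at this ⊢
  rwa [hae] at this

theorem cell_inner (h_pos : 0 < h) (h_lt : h < 1) (hρ₀ : UnifPosBdd ρ₀ (Ioo 0 h))
    (hρ₁ : UnifPosBdd ρ₁ (Ioo h 1)) (f g : CellL2 h ρ₀ ρ₁) {w : ℝ → ℂ}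
    (hw : f =ᵐ[volume.restrict (Ioo 0 1)] w) :
    ⟪f, g⟫_ℂ = ∫ x in Ioo 0 1, (cellDensity h ρ₀ ρ₁ x : ℂ) * g x * conj (w x) := by
  have h1 : ⟪f, g⟫_ℂ = ∫ x in Ioo 0 1, (cellDensity h ρ₀ ρ₁ x : ℂ) * g x * conj (f x) :=
    (unifPosBdd_cellDensity h_pos h_lt hρ₀ hρ₁).inner_wMeasure f g
  rw [h1]
  refine integral_congr_ae ?_
  filter_upwards [hw] with x hx
  rw [hx]

/-- Up to conjugation both pairings are the value of the Hermitian form at the same pair of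
functions. -/
theorem LimitOp.symm_form (h_pos : 0 < h) (h_lt : h < 1) (hρ₀ : UnifPosBdd ρ₀ (Ioo 0 h))
    (hρ₁ : UnifPosBdd ρ₁ (Ioo h 1)) {u f v g : VClosure h ρ₀ ρ₁ θ}
    (hu : LimitOp h a₀ ρ₀ ρ₁ θ u f) (hv : LimitOp h a₀ ρ₀ ρ₁ θ v g) : ⟪u, g⟫_ℂ = ⟪f, v⟫_ℂ := by
  have hcd := unifPosBdd_cellDensity h_pos h_lt hρ₀ hρ₁
  have hae : ae (cellMeasure h ρ₀ ρ₁) = ae (volume.restrict (Ioo 0 1)) := hcd.ae_wMeasure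
  obtain ⟨w, k, hw, huw, h1⟩ := hu
  obtain ⟨y, l, hy, hvy, h2⟩ := hv
  unfold EventuallyEq at huw hvy
  rw [hae] at huw hvy
  have e1 := h1 y l hy
  have e2 := h2 w k hw
  have i1 := cell_inner h_pos h_lt hρ₀ hρ₁ (u : CellL2 h ρ₀ ρ₁) (g : CellL2 h ρ₀ ρ₁) huw
  have i2 := cell_inner h_pos h_lt hρ₀ hρ₁ (v : CellL2 h ρ₀ ρ₁) (f : CellL2 h ρ₀ ρ₁) hvy
  rw [Submodule.coe_inner, i1, ← e2, Submodule.coe_inner, ← inner_conj_symm, i2, ← e1, conj_form]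

/-- The spectrum of `A_θ` consists of eigenvalues. -/
theorem mem_fibreSpectrum_iff (h_pos : 0 < h) (h_lt : h < 1) (ha₀ : UnifPosBdd a₀ (Ioo 0 h))
    (hρ₀ : UnifPosBdd ρ₀ (Ioo 0 h)) (hρ₁ : UnifPosBdd ρ₁ (Ioo h 1))
    (hM : 0 ≤ ∫ y in Ioo h 1, ρ₁ y) :
    z ∈ fibreSpectrum h a₀ ρ₀ ρ₁ θ ↔ ¬ NoEigen h a₀ ρ₀ θ z (∫ y in Ioo h 1, ρ₁ y) := by
  have hcd := unifPosBdd_cellDensity h_pos h_lt hρ₀ hρ₁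
  have hae : ae (cellMeasure h ρ₀ ρ₁) = ae (volume.restrict (Ioo 0 1)) := hcd.ae_wMeasure
  have hfm : ∀ f : VClosure h ρ₀ ρ₁ θ,
      MemLp (f : CellL2 h ρ₀ ρ₁) 2 (volume.restrict (Ioo 0 h)) :=
    fun f => memLp_mono_left h_lt (hcd.memLp_coe (f : CellL2 h ρ₀ ρ₁))
  have hex : ∀ z : ℂ, NoEigen h a₀ ρ₀ θ z (∫ y in Ioo h 1, ρ₁ y) →
      ∃ R : VClosure h ρ₀ ρ₁ θ → VClosure h ρ₀ ρ₁ θ,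
        ∀ f, LimitOp h a₀ ρ₀ ρ₁ θ (R f) (f + z • R f) := by
    intro z hno
    have : ∀ f : VClosure h ρ₀ ρ₁ θ, ∃ u : VClosure h ρ₀ ρ₁ θ,
        LimitOp h a₀ ρ₀ ρ₁ θ u (f + z • u) := by
      intro f
      obtain ⟨w, g, hw⟩ := hno.exists_weakSol h_pos ha₀ hρ₀
        (conj (phase θ) * ∫ y in Ioo h 1, (ρ₁ y : ℂ) * (f : CellL2 h ρ₀ ρ₁) y) (hfm f)
      obtain ⟨u, hu⟩ := hw.1.exists_mem_VClosure h_pos h_lt hρ₀ hρ₁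
      exact ⟨u, (limitOp_iff h_pos h_lt hρ₀ hρ₁ u f).2 ⟨w, g, hw, hu⟩⟩
    choose R hR using this
    exact ⟨R, hR⟩
  -- A resolvent maps `0` to `0`, so an eigenfunction vanishes almost everywhere, hence everywhere
  -- by continuity.
  refine not_congr ⟨fun ⟨R, hR⟩ w g hw => ?_, fun hno => ?_⟩
  · obtain ⟨u, hu⟩ := hw.1.exists_mem_VClosure h_pos h_lt hρ₀ hρ₁
    have h0 : ((0 : VClosure h ρ₀ ρ₁ θ) : CellL2 h ρ₀ ρ₁) =ᵐ[volume.restrict (Ioo 0 1)] 0 := by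
      have := Lp.coeFn_zero ℂ 2 (cellMeasure h ρ₀ ρ₁)
      unfold EventuallyEq at this ⊢
      rwa [hae] at this
    have h1 : LimitOp h a₀ ρ₀ ρ₁ θ u (0 + z • u) := by
      refine (limitOp_iff h_pos h_lt hρ₀ hρ₁ u 0).2 ⟨w, g, ⟨hw.1, fun v k hv => ?_⟩, hu⟩
      rw [hw.2 v k hv]
      have e1 : ∫ y in Ioo h 1, (ρ₁ y : ℂ) *
          ((0 : VClosure h ρ₀ ρ₁ θ) : CellL2 h ρ₀ ρ₁) y = 0 := by
        refine integral_eq_zero_of_ae ?_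
        filter_upwards [ae_restrict_of_ae_restrict_of_subset (Ioo_subset_Ioo_left h_pos.le) h0]
          with x hx
        rw [hx]
        simp
      rw [e1, mul_zero]
      congr 1
      refine integral_congr_ae ?_
      filter_upwards [ae_restrict_of_ae_restrict_of_subset (Ioo_subset_Ioo_right h_lt.le) h0]
        with x hx
      rw [hx]
    have h2 := (hR u 0).1 h1
    rw [map_zero] at h2
    subst h2
    refine eq_zero_of_ae_eq_zero h_pos hw.1.1.1.continuousOn ?_
    unfold EventuallyEq at h0 hu ⊢
    filter_upwards [ae_restrict_of_ae_restrict_of_subset (Ioo_subset_Ioo_right h_lt.le) h0,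
      ae_restrict_of_ae_restrict_of_subset (Ioo_subset_Ioo_right h_lt.le) hu,
      ae_restrict_mem measurableSet_Ioo] with x e1 e2 e3
    rw [← constExt_of_le (u := w) e3.2.le, ← e2, e1]
  · obtain ⟨R, hR⟩ := hex z hno
    obtain ⟨S, hS⟩ := hex (conj z) (hno.conj h_pos ha₀ hρ₀ hM)
    -- The symmetry identity for `A_θ` contains the term `conj z ⟪R f, S g⟫` on both sides.
    -- Cancelling it shows that `S` is adjoint to `R`, so `R` is linear and bounded.
    obtain ⟨T, hT⟩ := exists_clm_of_adjoint R S fun f g => by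
      have := (hR f).symm_form h_pos h_lt hρ₀ hρ₁ (hS g)
      rw [inner_add_right, inner_add_left] at this
      have e1 : ⟪z • R f, S g⟫_ℂ = conj z * ⟪R f, S g⟫_ℂ :=
        inner_smul_left (𝕜 := ℂ) (R f : CellL2 h ρ₀ ρ₁) (S g : CellL2 h ρ₀ ρ₁) z
      have e2 : ⟪R f, conj z • S g⟫_ℂ = conj z * ⟪R f, S g⟫_ℂ :=
        inner_smul_right (𝕜 := ℂ) (R f : CellL2 h ρ₀ ρ₁) (S g : CellL2 h ρ₀ ρ₁) (conj z)
      rw [e1, e2] at this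
      exact add_right_cancel this
    refine ⟨T, fun u f => ?_⟩
    rw [hT]
    refine ⟨fun hu => ?_, fun hu => hu ▸ hR f⟩
    obtain ⟨w, g, hw, huw⟩ := (limitOp_iff h_pos h_lt hρ₀ hρ₁ u f).1 hu
    obtain ⟨y, k, hy, hRy⟩ := (limitOp_iff h_pos h_lt hρ₀ hρ₁ (R f) f).1 (hR f)
    refine Subtype.ext (Lp.ext ?_)
    unfold EventuallyEq at *
    rw [hae]
    filter_upwards [huw, hRy, ae_restrict_mem measurableSet_Ioo] with x h1 h2 h3
    rw [h1, h2, constExt, constExt]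
    exact hno.weakSol_unique ha₀ hρ₀ (hfm f) hw hy ⟨le_min h3.1.le h_pos.le, min_le_right _ _⟩

end Cell

/-! ### Trace estimates at the end point. -/

section Trace

variable {h : ℝ} {u g : ℝ → ℂ}

theorem MemLp.integrable_norm_sq {μ : Measure ℝ} {f : ℝ → ℂ} (hf : MemLp f 2 μ) :
    Integrable (fun x => ‖f x‖ ^ 2) μ := hf.norm.integrable_sq

/-- A linear substitute for Cauchy–Schwarz: integrated, it bounds an `L¹` norm by the squared `L²`
norm with a free parameter `t`. -/
theorem le_add_sq_div (x : ℝ) {t : ℝ} (ht : 0 < t) : x ≤ t + x ^ 2 / t := by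
  have h1 : t + x ^ 2 / t = (t ^ 2 + x ^ 2) / t := by field_simp
  rw [h1, le_div_iff₀ ht]
  nlinarith [sq_nonneg (x - t), sq_nonneg (x + t)]

theorem H1With.norm_sub_le_of_le (hu : H1With 0 h u g) {x y t : ℝ} (hx : x ∈ Icc 0 h)
    (hy : y ∈ Icc 0 h) (hxy : x ≤ y) (ht : 0 < t) :
    ‖u y - u x‖ ≤ t * (y - x) + (∫ s in Ioo 0 h, ‖g s‖ ^ 2) / t := by
  have hsub : Ioo x y ⊆ Ioo 0 h := Ioo_subset_Ioo hx.1 hy.2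
  have hg2 := MemLp.integrable_norm_sq hu.2
  have hg2' : IntegrableOn (fun s => ‖g s‖ ^ 2) (Ioo x y) := IntegrableOn.mono_set hg2 hsub
  rw [hu.1.sub_eq_integral hx hy, intervalIntegral.integral_of_le hxy,
    integral_Ioc_eq_integral_Ioo]
  calc ‖∫ s in Ioo x y, g s‖ ≤ ∫ s in Ioo x y, (t + ‖g s‖ ^ 2 / t) := by
        refine norm_integral_le_of_norm_le ((integrable_const t).add (hg2'.div_const t)) ?_
        exact .of_forall fun s => le_add_sq_div _ ht
    _ = t * (y - x) + (∫ s in Ioo x y, ‖g s‖ ^ 2) / t := by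
        rw [integral_add (integrable_const t) (hg2'.div_const t), integral_div]
        simp [Measure.real, ENNReal.toReal_ofReal (sub_nonneg.2 hxy)]
        ring
    _ ≤ _ := by
        have := setIntegral_mono_set (μ := volume) hg2 (.of_forall fun s => by positivity)
          hsub.eventuallyLE
        gcongr

theorem H1With.norm_sub_le (hu : H1With 0 h u g) {x y t : ℝ} (hx : x ∈ Icc 0 h)
    (hy : y ∈ Icc 0 h) (ht : 0 < t) :
    ‖u y - u x‖ ≤ t * |y - x| + (∫ s in Ioo 0 h, ‖g s‖ ^ 2) / t := by
  rcases le_total x y with hxy | hxy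
  · rw [abs_of_nonneg (sub_nonneg.2 hxy)]
    exact hu.norm_sub_le_of_le hx hy hxy ht
  · rw [norm_sub_rev, abs_sub_comm, abs_of_nonneg (sub_nonneg.2 hxy)]
    exact hu.norm_sub_le_of_le hy hx hxy ht

/-- Average `‖u 0‖ ≤ ‖u y‖ + ‖u 0 - u y‖` over `y ∈ (0, δ)`, with separate parameters `s` and `t`
for the two terms. -/
theorem H1With.norm_apply_zero_le (hu : H1With 0 h u g) {δ s t : ℝ} (hδ : 0 < δ) (hδh : δ ≤ h)
    (hs : 0 < s) (ht : 0 < t) :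
    ‖u 0‖ ≤ s + t * δ + (∫ y in Ioo 0 h, ‖g y‖ ^ 2) / t +
      (∫ y in Ioo 0 h, ‖u y‖ ^ 2) / (s * δ) := by
  have hsub : Ioo 0 δ ⊆ Ioo 0 h := Ioo_subset_Ioo_right hδh
  have hu2 := MemLp.integrable_norm_sq (memLp_of_continuousOn hu.1.continuousOn 2)
  have hu2' : IntegrableOn (fun y => ‖u y‖ ^ 2) (Ioo 0 δ) := IntegrableOn.mono_set hu2 hsub
  set G := ∫ y in Ioo 0 h, ‖g y‖ ^ 2
  have h1 : ∫ _y in Ioo 0 δ, ‖u 0‖ ≤ ∫ y in Ioo 0 δ, ((s + t * δ + G / t) + ‖u y‖ ^ 2 / s) := by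
    refine setIntegral_mono_on (integrable_const _)
      ((integrable_const _).add (hu2'.div_const s)) measurableSet_Ioo fun y hy => ?_
    have h2 := hu.norm_sub_le (x := y) (y := 0) ⟨hy.1.le, hy.2.le.trans hδh⟩
      ⟨le_rfl, hδ.le.trans hδh⟩ ht
    have h3 : ‖u 0‖ ≤ ‖u y‖ + ‖u 0 - u y‖ := by
      simpa using norm_add_le (u y) (u 0 - u y)
    have h4 := le_add_sq_div ‖u y‖ hs
    have h5 : t * |0 - y| ≤ t * δ := by
      rw [zero_sub, abs_neg, abs_of_pos hy.1]
      exact mul_le_mul_of_nonneg_left hy.2.le ht.le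
    linarith
  rw [integral_add (integrable_const _) (hu2'.div_const s), integral_div] at h1
  simp only [integral_const, smul_eq_mul, MeasurableSet.univ, measureReal_restrict_apply,
    univ_inter, Real.volume_real_Ioo_of_le hδ.le, sub_zero] at h1
  have h6 : ∫ y in Ioo 0 δ, ‖u y‖ ^ 2 ≤ ∫ y in Ioo 0 h, ‖u y‖ ^ 2 :=
    setIntegral_mono_set hu2 (.of_forall fun s => by positivity) hsub.eventuallyLE
  have h7 : δ * ‖u 0‖ ≤ δ * (s + t * δ + G / t + (∫ y in Ioo 0 h, ‖u y‖ ^ 2) / (s * δ)) := by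
    refine h1.trans ?_
    rw [mul_add δ (s + t * δ + G / t)]
    have : δ * ((∫ y in Ioo 0 h, ‖u y‖ ^ 2) / (s * δ)) = (∫ y in Ioo 0 h, ‖u y‖ ^ 2) / s := by
      field_simp
    rw [this]
    gcongr
  exact le_of_mul_le_mul_left h7 hδ

/-- The trace at `0` is small if the derivative is bounded and the function is small in mean. -/
theorem exists_trace_bound (hh : 0 < h) {A ε : ℝ} (hA : 0 ≤ A) (hε : 0 < ε) :
    ∃ η > 0, ∀ u g, H1With 0 h u g → (∫ y in Ioo 0 h, ‖g y‖ ^ 2) ≤ A →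
      (∫ y in Ioo 0 h, ‖u y‖ ^ 2) ≤ η → ‖u 0‖ ≤ ε := by
  -- Four contributions of `ε / 4`: `t` is large enough for the energy term, then `δ` small enough
  -- for `t * δ`, `s = ε / 4`, and finally `η` controls the mean-square term.
  let t := 4 * (A + 1) / ε
  have ht : 0 < t := by positivity
  let δ := min h (ε / (4 * t))
  have hδ : 0 < δ := by positivity
  refine ⟨ε / 4 * (ε / 4 * δ), by positivity, fun u g hu hg hu2 => ?_⟩
  have h1 := hu.norm_apply_zero_le hδ (min_le_left _ _) (by positivity : 0 < ε / 4) ht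
  have h2 : t * δ ≤ ε / 4 := by
    calc t * δ ≤ t * (ε / (4 * t)) := by gcongr; exact min_le_right _ _
      _ = ε / 4 := by field_simp
  have h3 : (∫ y in Ioo 0 h, ‖g y‖ ^ 2) / t ≤ ε / 4 := by
    rw [div_le_iff₀ ht]
    have : ε / 4 * t = A + 1 := by simp only [t]; field_simp
    linarith
  have h4 : (∫ y in Ioo 0 h, ‖u y‖ ^ 2) / (ε / 4 * δ) ≤ ε / 4 := by
    rwa [div_le_iff₀ (by positivity)]
  linarith

end Trace

/-! ### Passing between `Lp` classes and their representatives. -/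

section WeightedNorm

variable {ρ : ℝ → ℝ} {s : Set ℝ}

theorem UnifPosBdd.exists_integral_norm_sq_le (hρ : UnifPosBdd ρ s) :
    ∃ C : ℝ, 0 < C ∧ ∀ (F : Lp ℂ 2 (wMeasure ρ s)) (f : ℝ → ℂ), F =ᵐ[volume.restrict s] f →
      ∫ x in s, ‖f x‖ ^ 2 ≤ C * ‖F‖ ^ 2 := by
  have hρ' := hρ
  obtain ⟨-, c, C, hc, hb⟩ := hρ'
  refine ⟨c⁻¹, by positivity, fun F f hFf => ?_⟩
  have hF := hρ.memLp_coe F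
  have e1 : ‖F‖ ^ 2 = ∫ x in s, ρ x * ‖F x‖ ^ 2 := by
    have h1 := hρ.inner_wMeasure F F
    rw [inner_self_eq_norm_sq_to_K] at h1
    have h2 : ∫ x in s, (ρ x : ℂ) * F x * conj (F x) =
        ((∫ x in s, ρ x * ‖F x‖ ^ 2 : ℝ) : ℂ) := by
      rw [← integral_complex_ofReal]
      refine integral_congr_ae (.of_forall fun x => ?_)
      simp only
      rw [mul_assoc, Complex.mul_conj, Complex.normSq_eq_norm_sq]; push_cast; ring
    rw [h2] at h1
    exact Complex.ofReal_injective ((Complex.ofReal_pow _ _).trans h1)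
  have e2 : ∫ x in s, ‖f x‖ ^ 2 = ∫ x in s, ‖F x‖ ^ 2 := by
    refine integral_congr_ae ?_
    filter_upwards [hFf] with x hx
    rw [hx]
  have hi : IntegrableOn (fun y => ρ y * ‖F y‖ ^ 2) s := by
    refine (hρ.integrable_mul_mul_conj hF hF).re.congr (.of_forall fun x => ?_)
    simp only
    rw [mul_assoc, Complex.mul_conj, Complex.normSq_eq_norm_sq]
    exact Complex.re_ofReal_mul _ _
  rw [e1, e2, ← integral_const_mul]
  refine integral_mono_ae (MemLp.integrable_norm_sq hF) (hi.const_mul _) ?_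
  filter_upwards [hb] with x hx
  rw [← mul_assoc]
  refine le_mul_of_one_le_left (by positivity) ?_
  rw [inv_mul_eq_div, one_le_div hc]
  exact hx.1

theorem UnifPosBdd.coeFn_toLp (hρ : UnifPosBdd ρ s) {f : ℝ → ℂ} (hf : MemLp f 2 (wMeasure ρ s)) :
    hf.toLp =ᵐ[volume.restrict s] f := by
  have := hf.coeFn_toLp
  unfold EventuallyEq at this ⊢
  rwa [hρ.ae_wMeasure] at this

theorem UnifPosBdd.coeFn_sub_smul (hρ : UnifPosBdd ρ s) {F G : Lp ℂ 2 (wMeasure ρ s)}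
    {f g : ℝ → ℂ} (hF : F =ᵐ[volume.restrict s] f) (hG : G =ᵐ[volume.restrict s] g) (c : ℂ) :
    ((F - c • G : Lp ℂ 2 (wMeasure ρ s)) : ℝ → ℂ) =ᵐ[volume.restrict s] f - c • g := by
  have h1 := Lp.coeFn_sub F (c • G)
  have h2 := Lp.coeFn_smul c G
  unfold EventuallyEq at *
  rw [hρ.ae_wMeasure] at h1 h2
  filter_upwards [h1, h2, hF, hG] with x e1 e2 e3 e4
  rw [e1, Pi.sub_apply, e2, Pi.smul_apply, e3, e4]
  rfl

theorem UnifPosBdd.inner_eq (hρ : UnifPosBdd ρ s) {F G : Lp ℂ 2 (wMeasure ρ s)} {f g : ℝ → ℂ}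
    (hF : F =ᵐ[volume.restrict s] f) (hG : G =ᵐ[volume.restrict s] g) :
    ⟪F, G⟫_ℂ = ∫ x in s, (ρ x : ℂ) * g x * conj (f x) := by
  rw [hρ.inner_wMeasure]
  refine integral_congr_ae ?_
  filter_upwards [hF, hG] with x h1 h2
  rw [h1, h2]

end WeightedNorm

/-! ### Pointwise convergence of the eigenfunction expansion at `0`. -/

section Expansion

variable {h : ℝ} {a ρ : ℝ → ℝ} {θ : ℝ} {μ : ℕ → ℝ} {Φ : ℕ → ℝ → ℂ}

/-- The eigenfunction expansion of a function in the form domain converges at the end point. -/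
theorem IsEigensystem.hasSum_apply_zero (hE : IsEigensystem h a ρ θ μ Φ) (hh : 0 < h)
    (ha : UnifPosBdd a (Ioo 0 h)) (hρ : UnifPosBdd ρ (Ioo 0 h)) {u g : ℝ → ℂ}
    (hu : H1QuasiPer h θ u g) :
    HasSum (fun n => (∫ y in Ioo 0 h, (ρ y : ℂ) * u y * conj (Φ n y)) * Φ n 0) (u 0) := by
  choose k hk hform using hE.eigen
  have mφ : ∀ n, MemLp (Φ n) 2 (wMeasure ρ (Ioo 0 h)) := fun n => hρ.memLp_wMeasure.2 (hk n).memLp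
  have mk : ∀ n, MemLp (k n) 2 (wMeasure a (Ioo 0 h)) := fun n => ha.memLp_wMeasure.2 (hk n).1.2
  have mu : MemLp u 2 (wMeasure ρ (Ioo 0 h)) := hρ.memLp_wMeasure.2 hu.memLp
  have mg : MemLp g 2 (wMeasure a (Ioo 0 h)) := ha.memLp_wMeasure.2 hu.1.2
  let φ : ℕ → Lp ℂ 2 (wMeasure ρ (Ioo 0 h)) := fun n => (mφ n).toLp
  let κ : ℕ → Lp ℂ 2 (wMeasure a (Ioo 0 h)) := fun n => (mk n).toLp
  let U : Lp ℂ 2 (wMeasure ρ (Ioo 0 h)) := mu.toLp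
  let V : Lp ℂ 2 (wMeasure a (Ioo 0 h)) := mg.toLp
  have cφ : ∀ n, φ n =ᵐ[volume.restrict (Ioo 0 h)] Φ n := fun n => hρ.coeFn_toLp (mφ n)
  have cκ : ∀ n, κ n =ᵐ[volume.restrict (Ioo 0 h)] k n := fun n => ha.coeFn_toLp (mk n)
  have cU : U =ᵐ[volume.restrict (Ioo 0 h)] u := hρ.coeFn_toLp mu
  have cV : V =ᵐ[volume.restrict (Ioo 0 h)] g := ha.coeFn_toLp mg
  have hon : Orthonormal ℂ φ := by
    rw [orthonormal_iff_ite]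
    intro m n
    rw [hρ.inner_eq (cφ m) (cφ n), hE.orthonormal n m]
    simp only [eq_comm]
  have hbot : (Submodule.span ℂ (range φ))ᗮ = ⊥ := by
    rw [Submodule.eq_bot_iff]
    intro f hf
    have h1 := hE.complete f (hρ.memLp_coe f) fun n => by
      rw [← hρ.inner_eq (cφ n) (EventuallyEq.refl _ (f : ℝ → ℂ))]
      exact (Submodule.mem_orthogonal _ _).1 hf _ (Submodule.subset_span ⟨n, rfl⟩)
    refine (Lp.eq_zero_iff_ae_eq_zero).2 ?_
    unfold EventuallyEq at h1 ⊢
    rwa [hρ.ae_wMeasure]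
  let b := HilbertBasis.mkOfOrthogonalEqBot hon hbot
  have hb : ∀ n, b n = φ n := fun n => by simp [b]
  let c : ℕ → ℂ := fun n => ∫ y in Ioo 0 h, (ρ y : ℂ) * u y * conj (Φ n y)
  have hc : ∀ n, ⟪φ n, U⟫_ℂ = c n := fun n => hρ.inner_eq (cφ n) cU
  have hsum : HasSum (fun n => c n • φ n) U := by
    have := b.hasSum_repr U
    simpa [HilbertBasis.repr_apply_apply, hb, hc] using this
  let rU : Finset ℕ → Lp ℂ 2 (wMeasure ρ (Ioo 0 h)) := fun S => U - ∑ n ∈ S, c n • φ n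
  let rV : Finset ℕ → Lp ℂ 2 (wMeasure a (Ioo 0 h)) := fun S => V - ∑ n ∈ S, c n • κ n
  -- The remainders in the two `L²` spaces are a function and its derivative from one quasi-periodic
  -- pair, so both the form identity and the trace bound apply to them.
  have hrep : ∀ S : Finset ℕ, ∃ r r', H1QuasiPer h θ r r' ∧
      rU S =ᵐ[volume.restrict (Ioo 0 h)] r ∧ rV S =ᵐ[volume.restrict (Ioo 0 h)] r' ∧
      r 0 = u 0 - ∑ n ∈ S, c n * Φ n 0 := by
    intro S
    induction S using Finset.induction_on with
    | empty => exact ⟨u, g, hu, by simpa [rU] using cU, by simpa [rV] using cV, by simp⟩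
    | insert n S hn ih =>
      obtain ⟨r, r', h1, h2, h3, h4⟩ := ih
      refine ⟨r - c n • Φ n, r' - c n • k n, h1.sub ((hk n).smul _), ?_, ?_, ?_⟩
      · have : rU (insert n S) = rU S - c n • φ n := by
          simp only [rU]; rw [Finset.sum_insert hn]; abel
        rw [this]
        exact hρ.coeFn_sub_smul h2 (cφ n) _
      · have : rV (insert n S) = rV S - c n • κ n := by
          simp only [rV]; rw [Finset.sum_insert hn]; abel
        rw [this]
        exact ha.coeFn_sub_smul h3 (cκ n) _
      · simp only [Pi.sub_apply, Pi.smul_apply, smul_eq_mul]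
        rw [Finset.sum_insert hn, h4]; ring
  have horth : ∀ S : Finset ℕ, ∀ n ∈ S, ⟪rU S, φ n⟫_ℂ = 0 := by
    intro S n hn
    simp only [rU]
    rw [inner_sub_left, hon.inner_left_sum c hn, ← hc, inner_conj_symm, sub_self]
  -- The form pairing of the remainder with `Φ n` is `μ n` times an `L²` pairing that vanishes for
  -- `n ∈ S`. Pythagoras then bounds the energy of the remainder by that of `u`, whatever the sign
  -- of `μ n`.
  have hV : ∀ S : Finset ℕ, ‖rV S‖ ≤ ‖V‖ := by
    intro S
    obtain ⟨r, r', h1, h2, h3, -⟩ := hrep S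
    have h5 : ∀ n ∈ S, ⟪rV S, κ n⟫_ℂ = 0 := fun n hn => by
      rw [ha.inner_eq h3 (cκ n), hform n r r' h1, ← hρ.inner_eq h2 (cφ n), horth S n hn, mul_zero]
    have h6 : ⟪rV S, ∑ n ∈ S, c n • κ n⟫_ℂ = 0 := by
      rw [inner_sum]
      exact Finset.sum_eq_zero fun n hn => by rw [inner_smul_right, h5 n hn, mul_zero]
    have h7 := norm_add_sq_eq_norm_sq_add_norm_sq_of_inner_eq_zero _ _ h6
    have h8 : rV S + ∑ n ∈ S, c n • κ n = V := by simp [rV]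
    rw [h8] at h7
    nlinarith [norm_nonneg (rV S), norm_nonneg V, norm_nonneg (∑ n ∈ S, c n • κ n)]
  have hU : Tendsto (fun S => ‖rU S‖) atTop (𝓝 0) := by
    have : Tendsto rU atTop (𝓝 (U - U)) := tendsto_const_nhds.sub hsum
    rw [sub_self] at this
    simpa using this.norm
  obtain ⟨Ca, hCa, hCa'⟩ := ha.exists_integral_norm_sq_le
  obtain ⟨Cρ, hCρ, hCρ'⟩ := hρ.exists_integral_norm_sq_le
  rw [HasSum, SummationFilter.unconditional_filter, Metric.tendsto_nhds]
  intro ε hε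
  -- Bounded energy and a small `L²` norm force a small trace; convergence in energy is not needed.
  obtain ⟨η, hη, H⟩ := exists_trace_bound hh (A := Ca * ‖V‖ ^ 2) (ε := ε / 2) (by positivity)
    (by positivity)
  have hU2 : Tendsto (fun S => Cρ * ‖rU S‖ ^ 2) atTop (𝓝 0) := by
    simpa using (hU.pow 2).const_mul Cρ
  filter_upwards [hU2.eventually_lt_const hη] with S hS
  obtain ⟨r, r', h1, h2, h3, h4⟩ := hrep S
  have h5 := H r r' h1.1 ((hCa' _ _ h3).trans (by have := hV S; gcongr))
    ((hCρ' _ _ h2).trans hS.le)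
  rw [dist_comm, dist_eq_norm, ← h4]
  linarith

end Expansion

/-! ### Eigenbases of compact symmetric operators. -/

section AbstractSpectral

variable {H : Type*} [NormedAddCommGroup H] [InnerProductSpace ℂ H]

/-- Orthonormal vectors lie at distance `√2 > 1`, so balls of radius `1/2` about them are disjoint
open sets in a separable space. -/
theorem Orthonormal.countable_index [TopologicalSpace.SeparableSpace H] {ι : Type*} {e : ι → H}
    (he : Orthonormal ℂ e) : Countable ι := by
  refine Pairwise.countable_of_isOpen_disjoint (s := fun i => Metric.ball (e i) (1 / 2)) ?_
    (fun _ => Metric.isOpen_ball) fun i => ⟨e i, Metric.mem_ball_self (by norm_num)⟩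
  intro i j hij
  refine Metric.ball_disjoint_ball ?_
  have h1 : ‖e i - e j‖ ^ 2 = 2 := by
    rw [@norm_sub_sq ℂ, he.1, he.1, he.2 hij]
    norm_num
  rw [dist_eq_norm]
  nlinarith [norm_nonneg (e i - e j)]

/-- An injective compact symmetric operator on a separable infinite-dimensional Hilbert space has a
complete orthonormal sequence of eigenvectors. -/
theorem exists_eigenbasis [CompleteSpace H] [TopologicalSpace.SeparableSpace H]
    (hinf : ¬ FiniteDimensional ℂ H) {T : H →L[ℂ] H} (hT : IsCompactOperator T)
    (hsymm : T.IsSymmetric) (hinj : ∀ f, T f = 0 → f = 0) :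
    ∃ (e : ℕ → H) (ν : ℕ → ℝ), Orthonormal ℂ e ∧ (Submodule.span ℂ (range e))ᗮ = ⊥ ∧
      ∀ n, ν n ≠ 0 ∧ T (e n) = (ν n : ℂ) • e n := by
  let E : ℂ → Submodule ℂ H := fun μ => Module.End.eigenspace (T : Module.End ℂ H) μ
  have hfd : ∀ μ, FiniteDimensional ℂ (E μ) := by
    intro μ
    by_cases hμ : μ = 0
    · have : E μ = ⊥ := by
        rw [Submodule.eq_bot_iff]
        intro x hx
        rw [Module.End.mem_eigenspace_iff, hμ, zero_smul] at hx
        exact hinj x hx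
      rw [this]
      infer_instance
    · exact T.finite_dimensional_eigenspace hT μ hμ
  -- All eigenvectors are indexed at once by eigenvalue and position in an orthonormal basis of the
  -- finite-dimensional eigenspace. The value `0` contributes nothing, by injectivity.
  let ι := Σ μ : ℂ, Fin (Module.finrank ℂ (E μ))
  let e : ι → H := fun i => (stdOrthonormalBasis ℂ (E i.1) i.2 : E i.1)
  have he : Orthonormal ℂ e :=
    hsymm.orthogonalFamily_eigenspaces.orthonormal_sigma_orthonormal
      (v_family := fun μ => stdOrthonormalBasis ℂ (E μ))
      fun μ => (stdOrthonormalBasis ℂ (E μ)).orthonormal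
  have hspan : (Submodule.span ℂ (range e))ᗮ = ⊥ := by
    have hle : ⨆ μ, E μ ≤ Submodule.span ℂ (range e) := by
      refine iSup_le fun μ x hx => ?_
      have h1 := (stdOrthonormalBasis ℂ (E μ)).sum_repr ⟨x, hx⟩
      have h2 : x = ∑ i, (stdOrthonormalBasis ℂ (E μ)).repr ⟨x, hx⟩ i • e ⟨μ, i⟩ := by
        have := congrArg (E μ).subtype h1
        simpa [e] using this.symm
      rw [h2]
      exact Submodule.sum_mem _ fun i _ =>
        Submodule.smul_mem _ _ (Submodule.subset_span ⟨⟨μ, i⟩, rfl⟩)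
    exact le_bot_iff.1 ((Submodule.orthogonal_le hle).trans
      (T.orthogonalComplement_iSup_eigenspaces_eq_bot hT hsymm).le)
  have hcount : Countable ι := Orthonormal.countable_index he
  -- A finite family would have a finite-dimensional span with trivial orthogonal complement, making
  -- `H` itself finite-dimensional.
  have hinfι : Infinite ι := by
    by_contra hfin
    rw [not_infinite_iff_finite] at hfin
    have : FiniteDimensional ℂ (Submodule.span ℂ (range e)) :=
      FiniteDimensional.span_of_finite ℂ (finite_range e)
    rw [Submodule.orthogonal_eq_bot_iff] at hspan
    rw [hspan] at this
    exact hinf (Module.Finite.equiv Submodule.topEquiv)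
  obtain ⟨φ⟩ := nonempty_equiv_of_countable (α := ℕ) (β := ι)
  have hmem : ∀ i, T (e i) = i.1 • e i := fun i =>
    Module.End.mem_eigenspace_iff.1 (stdOrthonormalBasis ℂ (E i.1) i.2).2
  have hne : ∀ i, e i ≠ 0 := fun i => he.ne_zero i
  refine ⟨e ∘ φ, fun n => (φ n).1.re, he.comp _ φ.injective, ?_, fun n => ?_⟩
  · rwa [φ.surjective.range_comp]
  · have hev : Module.End.HasEigenvalue (T : Module.End ℂ H) (φ n).1 :=
      Module.End.hasEigenvalue_of_hasEigenvector
        ⟨Module.End.mem_eigenspace_iff.2 (hmem _), hne _⟩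
    have hreal : (((φ n).1.re : ℝ) : ℂ) = (φ n).1 :=
      Complex.conj_eq_iff_re.1 (LinearMap.IsSymmetric.conj_eigenvalue_eq_self hsymm hev)
    refine ⟨fun h0 => hne (φ n) (hinj _ ?_), ?_⟩
    · rw [hmem, ← hreal, show (φ n).1.re = 0 from h0, Complex.ofReal_zero, zero_smul]
    · rw [Function.comp_apply, hmem, hreal]

end AbstractSpectral

/-! ### Existence of eigensystems on `(0, h)` through a compact resolvent. -/

section Existence

theorem ACWith.deriv_eq_zero {a b : ℝ} {u g : ℝ → ℂ} (hu : ACWith a b u g) (hab : a ≤ b)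
    (h0 : ∀ x ∈ Icc a b, u x = 0) : ∀ᵐ x ∂volume.restrict (Ioo a b), g x = 0 := by
  rw [ae_restrict_iff' measurableSet_Ioo]
  filter_upwards [hu.ae_hasDerivAt hab] with x hx hxm
  refine (hx hxm).unique ((hasDerivAt_const x (0 : ℂ)).congr_of_eventuallyEq ?_)
  filter_upwards [isOpen_Ioo.mem_nhds hxm] with y hy using h0 y (Ioo_subset_Icc_self hy)

variable {h : ℝ} {a ρ : ℝ → ℝ} {θ : ℝ}

theorem UnifPosBdd.isFiniteMeasure (hρ : UnifPosBdd ρ (Ioo 0 h)) :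
    IsFiniteMeasure (wMeasure ρ (Ioo 0 h)) := by
  obtain ⟨C, -, hb⟩ := hρ.exists_bound
  have hi : IntegrableOn ρ (Ioo 0 h) :=
    Integrable.of_bound hρ.1.aestronglyMeasurable C (hb.mono fun x hx => hx.2)
  exact isFiniteMeasure_withDensity_ofReal hi.2

/-- Indicators of the disjoint intervals `(h/(n+2), h/(n+1))` form an infinite orthogonal family of
nonzero vectors. -/
theorem UnifPosBdd.not_finiteDimensional (hρ : UnifPosBdd ρ (Ioo 0 h)) (hh : 0 < h) :
    ¬ FiniteDimensional ℂ (Lp ℂ 2 (wMeasure ρ (Ioo 0 h))) := by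
  intro hfd
  let s : ℕ → Set ℝ := fun n => Ioo (h / (n + 2)) (h / (n + 1))
  have hs : ∀ n, s n ⊆ Ioo 0 h := fun n x hx => by
    refine ⟨lt_trans (by positivity) hx.1, hx.2.trans_le (div_le_self hh.le ?_)⟩
    have : (0 : ℝ) ≤ n := n.cast_nonneg
    linarith
  have hdisj : ∀ m n, m < n → Disjoint (s m) (s n) := by
    intro m n hmn
    refine Set.disjoint_left.2 fun x h1 h2 => ?_
    have h3 : h / ((n : ℝ) + 1) ≤ h / (m + 2) := by
      have : (m : ℝ) + 1 ≤ n := by exact_mod_cast hmn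
      exact div_le_div_of_nonneg_left hh.le (by positivity) (by linarith)
    exact absurd (h1.1.trans (h2.2.trans_le h3)) (lt_irrefl _)
  have hm : ∀ n, MemLp (indicator (s n) (1 : ℝ → ℂ)) 2 (wMeasure ρ (Ioo 0 h)) := fun n =>
    hρ.memLp_wMeasure.2 ((memLp_const (1 : ℂ)).indicator measurableSet_Ioo)
  let f : ℕ → Lp ℂ 2 (wMeasure ρ (Ioo 0 h)) := fun n => (hm n).toLp
  have hf : ∀ n, f n =ᵐ[volume.restrict (Ioo 0 h)] indicator (s n) (1 : ℝ → ℂ) :=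
    fun n => hρ.coeFn_toLp (hm n)
  have hne : ∀ n, f n ≠ 0 := by
    intro n h0
    have h1 := (Lp.eq_zero_iff_ae_eq_zero).1 h0
    unfold EventuallyEq at h1
    rw [hρ.ae_wMeasure] at h1
    have h2 : ∀ᵐ x ∂volume.restrict (s n), False := by
      filter_upwards [ae_restrict_of_ae_restrict_of_subset (hs n) h1,
        ae_restrict_of_ae_restrict_of_subset (hs n) (hf n), ae_restrict_mem measurableSet_Ioo]
        with x e1 e2 e3
      rw [e2, indicator_of_mem e3] at e1
      simp at e1
    rw [eventually_false_iff_eq_bot, ae_eq_bot, Measure.restrict_eq_zero] at h2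
    simp only [s, Real.volume_Ioo, ENNReal.ofReal_eq_zero, sub_nonpos] at h2
    have : h / ((n : ℝ) + 2) < h / (n + 1) := by gcongr; norm_num
    exact this.not_ge h2
  have horth : Pairwise fun m n => ⟪f m, f n⟫_ℂ = 0 := by
    intro m n hmn
    rw [hρ.inner_eq (hf m) (hf n)]
    refine integral_eq_zero_of_ae (.of_forall fun x => ?_)
    have hd : Disjoint (s m) (s n) := by
      rcases lt_or_gt_of_ne hmn with h1 | h1
      · exact hdisj _ _ h1
      · exact (hdisj _ _ h1).symm
    by_cases hx : x ∈ s m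
    · simp [indicator_of_notMem (Set.disjoint_left.1 hd hx)]
    · simp [indicator_of_notMem hx]
  have hli : LinearIndependent ℂ f := linearIndependent_of_ne_zero_of_inner_eq_zero hne horth
  exact not_finite_iff_infinite.2 inferInstance hli.finite

/-- A bounded set of `H¹(0, h)` is relatively compact in `L²`. -/
theorem exists_isCompact_of_bounded (hh : 0 < h) (hρ : UnifPosBdd ρ (Ioo 0 h)) (G N : ℝ)
    (hG : 0 ≤ G) :
    ∃ K : Set (Lp ℂ 2 (wMeasure ρ (Ioo 0 h))), IsCompact K ∧ ∀ u g, H1With 0 h u g →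
      ∫ y in Ioo 0 h, ‖g y‖ ^ 2 ≤ G → ∫ y in Ioo 0 h, ‖u y‖ ^ 2 ≤ N →
      ∀ U : Lp ℂ 2 (wMeasure ρ (Ioo 0 h)), U =ᵐ[volume.restrict (Ioo 0 h)] u → U ∈ K := by
  have := hρ.isFiniteMeasure
  let X := BoundedContinuousFunction (Icc 0 h) ℂ
  -- The first four terms bound `‖u 0‖` by the trace estimate with `s = t = 1` and `δ = h`; `h + G`
  -- bounds the oscillation with `t = 1`.
  let B : ℝ := 1 + 1 * h + G / 1 + N / (1 * h) + (h + G)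
  let A : Set X := {F | (∀ x, ‖F x‖ ≤ B) ∧
    ∀ x y, ∀ t > 0, ‖F y - F x‖ ≤ t * |(y : ℝ) - x| + G / t}
  have hA : IsCompact (closure A) := by
    refine BoundedContinuousFunction.arzela_ascoli (Metric.closedBall 0 B)
      (isCompact_closedBall 0 B) A (fun F x hF => by simpa using hF.1 x) ?_
    intro x₀
    rw [Metric.equicontinuousAt_iff_right]
    intro ε hε
    let t := 2 * (G + 1) / ε
    have ht : 0 < t := by positivity
    have h1 : G / t < ε / 2 := by
      rw [div_lt_iff₀ ht]
      have : ε / 2 * t = G + 1 := by simp only [t]; field_simp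
      linarith
    filter_upwards [Metric.ball_mem_nhds x₀ (by positivity : 0 < ε / (2 * t))] with x hx F
    rw [dist_comm, dist_eq_norm]
    refine (F.2.2 x₀ x t ht).trans_lt ?_
    have h2 : |(x : ℝ) - x₀| < ε / (2 * t) := by
      rw [Metric.mem_ball, Subtype.dist_eq, Real.dist_eq] at hx
      exact hx
    have h3 : t * |(x : ℝ) - x₀| ≤ t * (ε / (2 * t)) := by gcongr
    have h4 : t * (ε / (2 * t)) = ε / 2 := by field_simp
    linarith
  -- Composition with the projection onto `[0, h]` turns a function on the interval into one on `ℝ`,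
  -- so the Arzelà–Ascoli compact set maps continuously into `L²`.
  let P : C(ℝ, Icc 0 h) := ⟨projIcc 0 h hh.le, continuous_projIcc⟩
  let ψ : X → Lp ℂ 2 (wMeasure ρ (Ioo 0 h)) := fun F =>
    BoundedContinuousFunction.toLp 2 (wMeasure ρ (Ioo 0 h)) ℂ (F.compContinuous P)
  have hψ : Continuous ψ := (ContinuousLinearMap.continuous _).comp
    (BoundedContinuousFunction.continuous_compContinuous P)
  refine ⟨ψ '' closure A, hA.image hψ, fun u g hu hg hu2 U hU => ?_⟩
  have hcont : Continuous fun x : Icc 0 h => u x :=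
    hu.1.continuousOn.comp_continuous continuous_subtype_val fun x => x.2
  let F : X := BoundedContinuousFunction.mkOfCompact ⟨fun x : Icc 0 h => u x, hcont⟩
  have hosc : ∀ x ∈ Icc 0 h, ∀ y ∈ Icc 0 h, ∀ t > 0, ‖u y - u x‖ ≤ t * |y - x| + G / t := by
    intro x hx y hy t ht
    refine (hu.norm_sub_le hx hy ht).trans ?_
    gcongr
  refine ⟨F, subset_closure ⟨fun x => ?_, fun x y t ht => hosc x x.2 y y.2 t ht⟩, ?_⟩
  · have h0 := hu.norm_apply_zero_le hh le_rfl one_pos one_pos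
    have h1 := hosc 0 (left_mem_Icc.2 hh.le) x x.2 1 one_pos
    have h2 : |(x : ℝ) - 0| ≤ h := by
      rw [sub_zero, abs_of_nonneg x.2.1]; exact x.2.2
    have h3 : ‖u x‖ ≤ ‖u 0‖ + ‖u x - u 0‖ := by
      simpa using norm_add_le (u 0) (u x - u 0)
    have h4 : (∫ y in Ioo 0 h, ‖u y‖ ^ 2) / (1 * h) ≤ N / (1 * h) := by gcongr
    change ‖u x‖ ≤ B
    simp only [B]
    linarith
  · refine Lp.ext ?_
    have h1 := BoundedContinuousFunction.coeFn_toLp 2 (wMeasure ρ (Ioo 0 h)) ℂ (F.compContinuous P)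
    unfold EventuallyEq at *
    rw [hρ.ae_wMeasure] at h1 ⊢
    filter_upwards [h1, hU, ae_restrict_mem measurableSet_Ioo] with x e1 e2 e3
    rw [e2]
    refine e1.trans ?_
    change u (projIcc 0 h hh.le x) = u x
    rw [projIcc_of_mem hh.le (Ioo_subset_Icc_self e3)]

/-- Since `-1` is not an eigenvalue, the inverse of "operator plus one" exists, and it is compact,
symmetric and injective. An eigenvalue `ν` of it corresponds to `μ = 1/ν - 1`. -/
theorem exists_isEigensystem (hh : 0 < h) (ha : UnifPosBdd a (Ioo 0 h))
    (hρ : UnifPosBdd ρ (Ioo 0 h)) (θ : ℝ) :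
    ∃ (μ : ℕ → ℝ) (Φ : ℕ → ℝ → ℂ), IsEigensystem h a ρ θ μ Φ := by
  have hno : NoEigen h a ρ θ (-1) 0 := by
    refine .of_not_nonneg hh ha hρ le_rfl ?_
    rintro ⟨l, hl, h1⟩
    have : (-1 : ℝ) = l := by exact_mod_cast h1
    linarith
  have hex : ∀ f : Lp ℂ 2 (wMeasure ρ (Ioo 0 h)), ∃ (U : Lp ℂ 2 (wMeasure ρ (Ioo 0 h)))
      (u g : ℝ → ℂ), WeakSol h a ρ θ (-1) 0 f 0 u g ∧ U =ᵐ[volume.restrict (Ioo 0 h)] u := by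
    intro f
    obtain ⟨u, g, hu⟩ := hno.exists_weakSol hh ha hρ 0 (hρ.memLp_coe f)
    have hm : MemLp u 2 (wMeasure ρ (Ioo 0 h)) := hρ.memLp_wMeasure.2 hu.1.memLp
    exact ⟨hm.toLp, u, g, hu, hρ.coeFn_toLp hm⟩
  choose R u g hw hRu using hex
  have hform : ∀ f v k, H1QuasiPer h θ v k →
      ∀ V : Lp ℂ 2 (wMeasure ρ (Ioo 0 h)), V =ᵐ[volume.restrict (Ioo 0 h)] v →
      ∫ y in Ioo 0 h, (a y : ℂ) * g f y * conj (k y) = ⟪V, f⟫_ℂ - ⟪V, R f⟫_ℂ := by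
    intro f v k hv V hV
    rw [(hw f).2 v k hv, hρ.inner_eq hV (hRu f), hρ.inner_eq hV (EventuallyEq.refl _ (f : ℝ → ℂ)),
      ← integral_sub (hρ.integrable_mul_mul_conj (hρ.memLp_coe f) hv.memLp)
        (hρ.integrable_mul_mul_conj (hw f).1.memLp hv.memLp)]
    simp only [Complex.ofReal_zero, mul_zero, zero_mul, add_zero]
    refine integral_congr_ae (.of_forall fun x => ?_)
    simp only
    ring
  have hsymm : ∀ f v, ⟪R f, v⟫_ℂ = ⟪f, R v⟫_ℂ := by
    intro f v
    have e1 := hform v (u f) (g f) (hw f).1 (R f) (hRu f)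
    have e2 := hform f (u v) (g v) (hw v).1 (R v) (hRu v)
    have e3 := conj_form (Ioo 0 h) a (g f) (g v)
    rw [e1, e2, map_sub, inner_conj_symm, inner_conj_symm] at e3
    linear_combination -e3
  obtain ⟨T, hT⟩ := exists_clm_of_adjoint R R hsymm
  have hTsymm : T.IsSymmetric := fun f v => by
    change ⟪T f, v⟫_ℂ = ⟪f, T v⟫_ℂ
    rw [hT, hT, hsymm]
  obtain ⟨Ca, hCa, hCa'⟩ := ha.exists_integral_norm_sq_le
  obtain ⟨Cρ, hCρ, hCρ'⟩ := hρ.exists_integral_norm_sq_le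
  have hcomp : IsCompactOperator T := by
    obtain ⟨K, hK, hK'⟩ := exists_isCompact_of_bounded hh hρ (Ca * ‖T‖) (Cρ * ‖T‖ ^ 2)
      (by positivity)
    refine ⟨K, hK, Filter.mem_of_superset (Metric.closedBall_mem_nhds 0 one_pos) fun f hf => ?_⟩
    rw [mem_closedBall_zero_iff] at hf
    have hTf : ‖R f‖ ≤ ‖T‖ := by
      rw [← hT]
      exact (T.le_opNorm f).trans (mul_le_of_le_one_right (norm_nonneg _) hf)
    rw [mem_preimage, hT]
    refine hK' (u f) (g f) (hw f).1.1 ?_ ?_ _ (hRu f)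
    · have hm : MemLp (g f) 2 (wMeasure a (Ioo 0 h)) := ha.memLp_wMeasure.2 (hw f).1.1.2
      have hc := ha.coeFn_toLp hm
      refine (hCa' hm.toLp _ hc).trans ?_
      gcongr
      -- Testing with the solution itself gives energy `Re ⟪R f, f⟫ - ‖R f‖² ≤ ‖T‖` on the unit
      -- ball.
      have e1 := hform f (u f) (g f) (hw f).1 (R f) (hRu f)
      rw [← ha.inner_eq hc hc] at e1
      have e2 := congrArg Complex.re e1
      rw [Complex.sub_re] at e2
      have e3 : (⟪hm.toLp, hm.toLp⟫_ℂ).re = ‖hm.toLp‖ ^ 2 := by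
        exact inner_self_eq_norm_sq (𝕜 := ℂ) _
      have e4 : (⟪R f, R f⟫_ℂ).re = ‖R f‖ ^ 2 := by
        exact inner_self_eq_norm_sq (𝕜 := ℂ) _
      have e5 : (⟪R f, f⟫_ℂ).re ≤ ‖R f‖ * ‖f‖ := re_inner_le_norm (𝕜 := ℂ) _ _
      have e6 : ‖R f‖ * ‖f‖ ≤ ‖T‖ := by
        calc ‖R f‖ * ‖f‖ ≤ ‖T‖ * 1 := by gcongr
          _ = ‖T‖ := mul_one _
      rw [e3, e4] at e2
      nlinarith [sq_nonneg ‖R f‖]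
    · refine (hCρ' _ _ (hRu f)).trans ?_
      gcongr
  -- A vanishing solution has vanishing flux, by the first equation, and then `ρ f = 0` by the
  -- second.
  have hinj : ∀ f, T f = 0 → f = 0 := by
    intro f hf
    rw [hT] at hf
    have hu0 : ∀ x ∈ Icc 0 h, u f x = 0 := by
      refine eq_zero_of_ae_eq_zero hh (hw f).1.1.1.continuousOn ?_
      have h1 := hRu f
      rw [hf] at h1
      have h2 := Lp.coeFn_zero ℂ 2 (wMeasure ρ (Ioo 0 h))
      unfold EventuallyEq at h1 h2 ⊢
      rw [hρ.ae_wMeasure] at h2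
      filter_upwards [h1, h2] with x e1 e2
      rw [← e1, e2]
    obtain ⟨w, hs, -⟩ := (hw f).exists_isSol hh ha hρ (hρ.memLp_coe f)
    obtain ⟨A, -, hA⟩ := ha.inv.exists_bound
    obtain ⟨B, -, hB⟩ := hρ.exists_bound
    have hw0 : ∀ x ∈ Icc 0 h, w x = 0 := by
      refine eq_zero_of_ae_eq_zero hh hs.2.continuousOn ?_
      filter_upwards [hs.1.deriv_eq_zero hh.le hu0, hA] with x e1 e2
      exact (mul_eq_zero.1 e1).resolve_left (Complex.ofReal_ne_zero.2 e2.1.ne')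
    refine (Lp.eq_zero_iff_ae_eq_zero).2 ?_
    unfold EventuallyEq
    rw [hρ.ae_wMeasure]
    filter_upwards [hs.2.deriv_eq_zero hh.le hw0, hB, ae_restrict_mem measurableSet_Ioo]
      with x e1 e2 e3
    rw [hu0 x (Ioo_subset_Icc_self e3), mul_zero, zero_add] at e1
    exact (mul_eq_zero.1 (neg_eq_zero.1 e1)).resolve_left (Complex.ofReal_ne_zero.2 e2.1.ne')
  have := hρ.isFiniteMeasure
  have : Fact ((2 : ENNReal) ≠ ⊤) := ⟨by norm_num⟩
  obtain ⟨e, ν, he, hspan, hev⟩ := exists_eigenbasis (hρ.not_finiteDimensional hh) hcomp hTsymm hinj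
  have hRe : ∀ n, R (e n) = (ν n : ℂ) • e n := fun n => by rw [← hT, (hev n).2]
  have hν : ∀ n, (ν n : ℂ) ≠ 0 := fun n => Complex.ofReal_ne_zero.2 (hev n).1
  -- Values at `0` require the continuous representative of `e n`, namely `1/ν` times the weak
  -- solution with datum `e n`.
  have heΦ : ∀ n, e n =ᵐ[volume.restrict (Ioo 0 h)] (ν n : ℂ)⁻¹ • u (e n) := by
    intro n
    have h1 := Lp.coeFn_smul (ν n : ℂ) (e n)
    have h2 := hRu (e n)
    rw [hRe] at h2
    unfold EventuallyEq at h1 h2 ⊢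
    rw [hρ.ae_wMeasure] at h1
    filter_upwards [h1, h2] with x e1 e2
    rw [e2, Pi.smul_apply, smul_eq_mul] at e1
    rw [Pi.smul_apply, smul_eq_mul, e1, inv_mul_cancel_left₀ (hν n)]
  refine ⟨fun n => (ν n)⁻¹ - 1, fun n => (ν n : ℂ)⁻¹ • u (e n), fun n =>
    ⟨(ν n : ℂ)⁻¹ • g (e n), (hw (e n)).1.smul _, fun v k hv => ?_⟩,
    fun m n => ?_, fun f hf h0 => ?_⟩
  · have hm : MemLp v 2 (wMeasure ρ (Ioo 0 h)) := hρ.memLp_wMeasure.2 hv.memLp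
    have hc := hρ.coeFn_toLp hm
    have e1 := hform (e n) v k hv hm.toLp hc
    rw [← hρ.inner_eq hc (heΦ n)]
    have e2 : ∫ y in Ioo 0 h, (a y : ℂ) * ((ν n : ℂ)⁻¹ • g (e n)) y * conj (k y) =
        (ν n : ℂ)⁻¹ * ∫ y in Ioo 0 h, (a y : ℂ) * g (e n) y * conj (k y) := by
      rw [← integral_const_mul]
      refine integral_congr_ae (.of_forall fun x => ?_)
      simp only [Pi.smul_apply, smul_eq_mul]
      ring
    rw [e2, e1, hRe, inner_smul_right]
    have := hν n
    push_cast
    field_simp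
  · rw [← hρ.inner_eq (heΦ n) (heΦ m), orthonormal_iff_ite.1 he n m]
    simp only [eq_comm]
  · have hm : MemLp f 2 (wMeasure ρ (Ioo 0 h)) := hρ.memLp_wMeasure.2 hf
    have hc := hρ.coeFn_toLp hm
    have hz : hm.toLp = 0 := by
      rw [← Submodule.mem_bot ℂ, ← hspan, Submodule.mem_orthogonal]
      intro y hy
      induction hy using Submodule.span_induction with
      | mem y hy =>
        obtain ⟨n, rfl⟩ := hy
        rw [hρ.inner_eq (heΦ n) hc]
        exact h0 n
      | zero => exact inner_zero_left _
      | add x y _ _ hx hy => rw [inner_add_left, hx, hy, add_zero]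
      | smul c x _ hx => rw [inner_smul_left, hx, mul_zero]
    have h2 := (Lp.eq_zero_iff_ae_eq_zero).1 hz
    unfold EventuallyEq at h2 hc ⊢
    rw [hρ.ae_wMeasure] at h2
    filter_upwards [hc, h2] with x e1 e2
    rw [← e1, e2]

end Existence

/-! ### Real fundamental systems. -/

section FundamentalSystem

variable {h : ℝ} {a ρ : ℝ → ℝ} {lam : ℝ}

theorem IsSolution.isSol (hh : 0 ≤ h) (ha : UnifPosBdd a (Ioo 0 h)) {v w : ℝ → ℝ}
    (hv : IsSolution h a ρ lam v w) :
    IsSol h a ρ lam 0 (fun x => (v x : ℂ)) (fun x => (w x : ℂ)) := by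
  obtain ⟨⟨g, hg, hw⟩, hac⟩ := hv
  obtain ⟨C, -, hb⟩ := ha.exists_bound
  refine ⟨(hg.clm_comp Complex.ofRealCLM).congr hh (fun _ _ => rfl) ?_,
    (hac.clm_comp Complex.ofRealCLM).congr hh (fun _ _ => rfl) (.of_forall fun x => ?_)⟩
  · filter_upwards [hw, hb] with x h1 h2
    rw [h1, Complex.ofRealCLM_apply, ← Complex.ofReal_mul, inv_mul_cancel_left₀ h2.1.ne']
  · simp only [Pi.zero_apply, Complex.ofRealCLM_apply]
    push_cast
    ring

/-- The coefficients and `lam` are real, so real parts solve the same equation; this supplies the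
real fundamental system from the complex one. -/
theorem IsSol.isSolution_re (hh : 0 ≤ h) (ha : UnifPosBdd a (Ioo 0 h)) {v w : ℝ → ℂ}
    (hv : IsSol h a ρ lam 0 v w) :
    IsSolution h a ρ lam (fun x => (v x).re) (fun x => (w x).re) := by
  obtain ⟨C, -, hb⟩ := ha.exists_bound
  refine ⟨⟨fun x => (a x)⁻¹ * (w x).re,
    (hv.1.clm_comp Complex.reCLM).congr hh (fun _ _ => rfl) (.of_forall fun x => ?_), ?_⟩,
    (hv.2.clm_comp Complex.reCLM).congr hh (fun _ _ => rfl) (.of_forall fun x => ?_)⟩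
  · simp only [Complex.reCLM_apply, Complex.re_ofReal_mul]
  · filter_upwards [hb] with x h1
    rw [mul_inv_cancel_left₀ h1.1.ne']
  · simp only [Complex.reCLM_apply, Complex.neg_re, Complex.re_ofReal_mul, Pi.zero_apply, add_zero]
    ring

theorem IsFundamentalSystem.isFund (hh : 0 ≤ h) (ha : UnifPosBdd a (Ioo 0 h))
    {v₁ w₁ v₂ w₂ : ℝ → ℝ} (hf : IsFundamentalSystem h a ρ lam v₁ w₁ v₂ w₂) :
    IsFund h a ρ lam (fun x => (v₁ x : ℂ)) (fun x => (w₁ x : ℂ)) (fun x => (v₂ x : ℂ))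
      (fun x => (w₂ x : ℂ)) :=
  ⟨hf.sol₁.isSol hh ha, hf.sol₂.isSol hh ha, by simp [hf.v₁_zero], by simp [hf.w₁_zero],
    by simp [hf.v₂_zero], by simp [hf.w₂_zero]⟩

theorem exists_isFundamentalSystem (hh : 0 ≤ h) (ha : UnifPosBdd a (Ioo 0 h))
    (hρ : UnifPosBdd ρ (Ioo 0 h)) (lam : ℝ) :
    ∃ v₁ w₁ v₂ w₂ : ℝ → ℝ, IsFundamentalSystem h a ρ lam v₁ w₁ v₂ w₂ := by
  obtain ⟨v₁, w₁, v₂, w₂, hf⟩ := exists_isFund hh ha hρ (lam : ℂ)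
  exact ⟨_, _, _, _, hf.sol₁.isSolution_re hh ha, hf.sol₂.isSolution_re hh ha,
    by simp [hf.v₁_zero], by simp [hf.w₁_zero], by simp [hf.v₂_zero], by simp [hf.w₂_zero]⟩

theorem IsFundamentalSystem.wronskian (hh : 0 ≤ h) (ha : UnifPosBdd a (Ioo 0 h))
    {v₁ w₁ v₂ w₂ : ℝ → ℝ} (hf : IsFundamentalSystem h a ρ lam v₁ w₁ v₂ w₂) :
    v₁ h * w₂ h - w₁ h * v₂ h = 1 := by
  have := (hf.isFund hh ha).wronskian (right_mem_Icc.2 hh)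
  exact_mod_cast this

theorem IsFundamentalSystem.noEigen_iff (hh : 0 < h) (ha : UnifPosBdd a (Ioo 0 h))
    (hρ : UnifPosBdd ρ (Ioo 0 h)) {v₁ w₁ v₂ w₂ : ℝ → ℝ}
    (hf : IsFundamentalSystem h a ρ lam v₁ w₁ v₂ w₂) (θ M : ℝ) :
    NoEigen h a ρ θ lam M ↔ v₁ h + w₂ h - lam * v₂ h * M ≠ 2 * Real.cos θ := by
  rw [(hf.isFund hh.le ha).noEigen_iff hh ha hρ, not_iff_not, ← Complex.ofReal_inj]
  push_cast
  rw [mul_right_comm]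

end FundamentalSystem

/-! ### The Green function in terms of eigenfunctions. -/

section Eigensystem

variable {h : ℝ} {a ρ : ℝ → ℝ} {θ lam : ℝ} {μ : ℕ → ℝ} {Φ : ℕ → ℝ → ℂ}

/-- The expansion coefficients of a solution with a point source at the end point. -/
theorem IsEigensystem.coeff_mul (hE : IsEigensystem h a ρ θ μ Φ)
    {u g : ℝ → ℂ} {d : ℂ} (hu : WeakSol h a ρ θ lam 0 0 d u g) (n : ℕ) :
    ((μ n : ℂ) - lam) * ∫ y in Ioo 0 h, (ρ y : ℂ) * u y * conj (Φ n y) = d * conj (Φ n 0) := by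
  obtain ⟨k, hk, hform⟩ := hE.eigen n
  have e1 := hu.2 _ _ hk
  have e2 := hform u g hu.1
  have e3 := conj_form (Ioo 0 h) a k g
  rw [e2, map_mul, conj_form, Complex.conj_ofReal, e1] at e3
  have e4 : ∫ y in Ioo 0 h, (ρ y : ℂ) * ((lam : ℂ) * u y + (0 : ℝ → ℂ) y) * conj (Φ n y) =
      lam * ∫ y in Ioo 0 h, (ρ y : ℂ) * u y * conj (Φ n y) := by
    rw [← integral_const_mul]
    refine integral_congr_ae (.of_forall fun x => ?_)
    simp only [Pi.zero_apply, add_zero]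
    ring
  rw [e4] at e3
  simp only [Complex.ofReal_zero, mul_zero, zero_mul, add_zero] at e3
  linear_combination e3

/-- The coefficients of a homogeneous solution satisfy `(μ n - lam) cₙ = 0`, so completeness makes
the solution vanish when no `μ n` equals `lam`. -/
theorem IsEigensystem.noEigen_iff (hE : IsEigensystem h a ρ θ μ Φ) (hh : 0 < h) :
    NoEigen h a ρ θ lam 0 ↔ ∀ n, μ n ≠ lam := by
  constructor
  · rintro hno n rfl
    obtain ⟨k, hk, hform⟩ := hE.eigen n
    have hw : WeakSol h a ρ θ (μ n) 0 0 0 (Φ n) k := by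
      refine ⟨hk, fun v l hv => ?_⟩
      rw [hform v l hv, ← integral_const_mul]
      simp only [Complex.ofReal_zero, mul_zero, zero_mul, add_zero]
      refine integral_congr_ae (.of_forall fun x => ?_)
      simp only [Pi.zero_apply, add_zero]
      ring
    have h0 := hno _ _ hw
    have h1 := hE.orthonormal n n
    rw [setIntegral_eq_zero_of_forall_eq_zero, if_pos rfl] at h1
    · exact zero_ne_one h1
    · intro x hx
      rw [h0 x (Ioo_subset_Icc_self hx)]
      simp
  · intro hne u g hu
    refine eq_zero_of_ae_eq_zero hh hu.1.1.1.continuousOn (hE.complete u hu.1.memLp fun n => ?_)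
    have h1 := hE.coeff_mul hu n
    rw [zero_mul] at h1
    refine (mul_eq_zero.1 h1).resolve_left ?_
    rw [← Complex.ofReal_sub]
    exact Complex.ofReal_ne_zero.2 (sub_ne_zero.2 (hne n))

/-- The value at `0` of the solution with unit source at the end point is computed twice: from the
eigenfunction expansion and from the fundamental system. -/
theorem IsEigensystem.hasSum_green (hE : IsEigensystem h a ρ θ μ Φ) (hh : 0 < h)
    (ha : UnifPosBdd a (Ioo 0 h)) (hρ : UnifPosBdd ρ (Ioo 0 h)) {v₁ w₁ v₂ w₂ : ℝ → ℝ}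
    (hf : IsFundamentalSystem h a ρ lam v₁ w₁ v₂ w₂) (hne : ∀ n, μ n ≠ lam) :
    HasSum (fun n => lam / (μ n - lam) * ‖Φ n 0‖ ^ 2)
      (lam * (v₂ h / (v₁ h + w₂ h - 2 * Real.cos θ))) := by
  have hno := (hE.noEigen_iff hh).2 hne
  obtain ⟨u, g, hu⟩ := hno.exists_weakSol hh ha hρ 1 (F := 0) MemLp.zero
  have hD : v₁ h + w₂ h - 2 * Real.cos θ ≠ 0 := by
    have := (hf.noEigen_iff hh ha hρ θ 0).1 hno
    rw [mul_zero, sub_zero] at this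
    exact sub_ne_zero.2 this
  have h0 : u 0 = ((v₂ h / (v₁ h + w₂ h - 2 * Real.cos θ) : ℝ) : ℂ) := by
    have h1 := (hf.isFund hh.le ha).weakSol_apply_zero hh ha hρ hu
    rw [Complex.ofReal_div, eq_div_iff (Complex.ofReal_ne_zero.2 hD), ← h1]
    push_cast
    ring
  have hs := hE.hasSum_apply_zero hh ha hρ hu.1
  have hterm : ∀ n, (∫ y in Ioo 0 h, (ρ y : ℂ) * u y * conj (Φ n y)) * Φ n 0 =
      ((‖Φ n 0‖ ^ 2 / (μ n - lam) : ℝ) : ℂ) := by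
    intro n
    have h1 := hE.coeff_mul hu n
    have h2 : ((μ n - lam : ℝ) : ℂ) ≠ 0 := Complex.ofReal_ne_zero.2 (sub_ne_zero.2 (hne n))
    rw [Complex.ofReal_div, eq_div_iff h2, Complex.ofReal_pow, ← Complex.mul_conj']
    push_cast
    linear_combination Φ n 0 * h1
  simp_rw [hterm, h0] at hs
  rw [Complex.hasSum_ofReal] at hs
  refine (hs.mul_left lam).congr_fun fun n => ?_
  ring

end Eigensystem

/-! ### The dispersion relation and the limit spectrum. -/

section Limit

variable {h : ℝ} {a₀ ρ₀ ρ₁ : ℝ → ℝ} {lam : ℝ}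

theorem UnifPosBdd.setIntegral_pos {ρ : ℝ → ℝ} {a b : ℝ} (hρ : UnifPosBdd ρ (Ioo a b))
    (hab : a < b) : 0 < ∫ y in Ioo a b, ρ y := by
  obtain ⟨C, -, hb⟩ := hρ.exists_bound
  have hi : IntegrableOn ρ (Ioo a b) :=
    Integrable.of_bound hρ.1.aestronglyMeasurable C (hb.mono fun x hx => hx.2)
  have hn : 0 ≤ᵐ[volume.restrict (Ioo a b)] ρ := hb.mono fun x hx => hx.1.le
  refine lt_of_le_of_ne (integral_nonneg_of_ae hn) fun h0 => ?_
  rw [eq_comm, setIntegral_eq_zero_iff_of_nonneg_ae hn hi] at h0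
  have : ∀ᵐ x ∂volume.restrict (Ioo a b), False := by
    filter_upwards [hb, h0] with x h3 h4
    exact h3.1.ne' h4
  rw [eventually_false_iff_eq_bot, ae_eq_bot, Measure.restrict_eq_zero] at this
  simp [hab.not_ge] at this

theorem exists_cos_eq_iff (x : ℝ) :
    (∃ θ ∈ Ico (0 : ℝ) (2 * Real.pi), x = 2 * Real.cos θ) ↔ |x| ≤ 2 := by
  constructor
  · rintro ⟨θ, -, rfl⟩
    rw [abs_mul, abs_two]
    linarith [Real.abs_cos_le_one θ]
  · intro hx
    rw [abs_le] at hx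
    refine ⟨Real.arccos (x / 2), ⟨Real.arccos_nonneg _, ?_⟩, ?_⟩
    · linarith [Real.arccos_le_pi (x / 2), Real.pi_pos]
    · rw [Real.cos_arccos (by linarith) (by linarith)]
      ring

theorem mem_limitSpectrum_iff {z : ℂ} :
    z ∈ limitSpectrum h a₀ ρ₀ ρ₁ ↔
      ∃ θ ∈ Ico (0 : ℝ) (2 * Real.pi), z ∈ fibreSpectrum h a₀ ρ₀ ρ₁ θ := by
  simp only [limitSpectrum, mem_iUnion, exists_prop]

end Limit

end HighContrast

end

theorem mainTheorem6 (h : ℝ) (h_pos : 0 < h) (h_lt : h < 1) (a₀ ρ₀ ρ₁ : ℝ → ℝ)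
    (ha₀ : HighContrast.UnifPosBdd a₀ (Set.Ioo 0 h))
    (hρ₀ : HighContrast.UnifPosBdd ρ₀ (Set.Ioo 0 h))
    (hρ₁ : HighContrast.UnifPosBdd ρ₁ (Set.Ioo h 1)) :
    -- the limit spectrum consists of non-negative reals
    (∀ z ∈ HighContrast.limitSpectrum h a₀ ρ₀ ρ₁, ∃ lam : ℝ, 0 ≤ lam ∧ z = (lam : ℂ)) ∧
    -- the fundamental systems and the eigenfunction sequences exist
    (∀ lam : ℝ, 0 ≤ lam → ∃ v₁ w₁ v₂ w₂ : ℝ → ℝ,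
      HighContrast.IsFundamentalSystem h a₀ ρ₀ lam v₁ w₁ v₂ w₂) ∧
    (∀ θ ∈ Set.Ico (0 : ℝ) (2 * Real.pi), ∃ (μ : ℕ → ℝ) (Φ : ℕ → ℝ → ℂ),
      HighContrast.IsEigensystem h a₀ ρ₀ θ μ Φ) ∧
    ∀ lam : ℝ, 0 ≤ lam → ∀ v₁ w₁ v₂ w₂ : ℝ → ℝ,
      HighContrast.IsFundamentalSystem h a₀ ρ₀ lam v₁ w₁ v₂ w₂ →
      -- the description through the fundamental system
      ((lam : ℂ) ∈ HighContrast.limitSpectrum h a₀ ρ₀ ρ₁ ↔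
        |v₁ h + w₂ h - lam * v₂ h * ∫ y in Set.Ioo h 1, ρ₁ y| ≤ 2) ∧
      -- the description through the spectral decomposition
      ∀ (μ : ℝ → ℕ → ℝ) (Φ : ℝ → ℕ → ℝ → ℂ),
        (∀ θ ∈ Set.Ico (0 : ℝ) (2 * Real.pi),
          HighContrast.IsEigensystem h a₀ ρ₀ θ (μ θ) (Φ θ)) →
        (∀ θ ∈ Set.Ico (0 : ℝ) (2 * Real.pi), (∀ n, μ θ n ≠ lam) →
          ((lam : ℂ) ∈ HighContrast.fibreSpectrum h a₀ ρ₀ ρ₁ θ ↔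
            HasSum (fun n => lam / (μ θ n - lam) * ‖Φ θ n 0‖ ^ 2)
              (∫ y in Set.Ioo h 1, ρ₁ y)⁻¹)) ∧
        (lam ≠ 0 → ¬ (v₂ h = 0 ∧ |v₁ h| = 1) →
          ((lam : ℂ) ∈ HighContrast.limitSpectrum h a₀ ρ₀ ρ₁ ↔
            ∃ θ ∈ Set.Ico (0 : ℝ) (2 * Real.pi), (∀ n, μ θ n ≠ lam) ∧
              HasSum (fun n => lam / (μ θ n - lam) * ‖Φ θ n 0‖ ^ 2)
                (∫ y in Set.Ioo h 1, ρ₁ y)⁻¹)) := by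
  have hM := hρ₁.setIntegral_pos h_lt
  have hmem : ∀ (z : ℂ) (θ : ℝ), z ∈ HighContrast.fibreSpectrum h a₀ ρ₀ ρ₁ θ ↔
      ¬ HighContrast.NoEigen h a₀ ρ₀ θ z (∫ y in Set.Ioo h 1, ρ₁ y) := fun z θ =>
    HighContrast.mem_fibreSpectrum_iff h_pos h_lt ha₀ hρ₀ hρ₁ hM.le
  refine ⟨fun z hz => ?_,
    fun lam _ => HighContrast.exists_isFundamentalSystem h_pos.le ha₀ hρ₀ lam,
    fun θ _ => HighContrast.exists_isEigensystem h_pos ha₀ hρ₀ θ,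
    fun lam _ v₁ w₁ v₂ w₂ hf => ?_⟩
  · obtain ⟨θ, -, hθ⟩ := HighContrast.mem_limitSpectrum_iff.1 hz
    by_contra hneg
    exact (hmem z θ).1 hθ (.of_not_nonneg h_pos ha₀ hρ₀ hM.le hneg)
  · set M := ∫ y in Set.Ioo h 1, ρ₁ y
    have hfib : ∀ θ : ℝ, (lam : ℂ) ∈ HighContrast.fibreSpectrum h a₀ ρ₀ ρ₁ θ ↔
        v₁ h + w₂ h - lam * v₂ h * M = 2 * Real.cos θ := fun θ => by
      rw [hmem, hf.noEigen_iff h_pos ha₀ hρ₀, not_not]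
    refine ⟨?_, fun μ Φ hE => ?_⟩
    · rw [HighContrast.mem_limitSpectrum_iff, ← HighContrast.exists_cos_eq_iff]
      simp only [hfib]
    · have hpart : ∀ θ ∈ Set.Ico (0 : ℝ) (2 * Real.pi), (∀ n, μ θ n ≠ lam) →
          ((lam : ℂ) ∈ HighContrast.fibreSpectrum h a₀ ρ₀ ρ₁ θ ↔
            HasSum (fun n => lam / (μ θ n - lam) * ‖Φ θ n 0‖ ^ 2) M⁻¹) := by
        intro θ hθ hne
        have hs := (hE θ hθ).hasSum_green h_pos ha₀ hρ₀ hf hne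
        have hD : v₁ h + w₂ h - 2 * Real.cos θ ≠ 0 := by
          have := (hf.noEigen_iff h_pos ha₀ hρ₀ θ 0).1 (((hE θ hθ).noEigen_iff h_pos).2 hne)
          rw [mul_zero, sub_zero] at this
          exact sub_ne_zero.2 this
        -- Clearing the nonzero denominators `M` and `v₁ h + w₂ h - 2 cos θ` turns the Green
        -- function equation into the dispersion relation.
        have hiff : lam * (v₂ h / (v₁ h + w₂ h - 2 * Real.cos θ)) = M⁻¹ ↔
            v₁ h + w₂ h - lam * v₂ h * M = 2 * Real.cos θ := by
          rw [inv_eq_one_div, eq_div_iff hM.ne', ← mul_div_assoc, div_mul_eq_mul_div,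
            div_eq_one_iff_eq hD]
          constructor <;> intro h1 <;> linarith
        rw [hfib, ← hiff]
        exact ⟨fun h1 => h1 ▸ hs, fun h1 => hs.unique h1⟩
      refine ⟨hpart, fun hlam hexc => ?_⟩
      rw [HighContrast.mem_limitSpectrum_iff]
      constructor
      · rintro ⟨θ, hθ, hmemθ⟩
        -- If some `μ θ n` were `lam`, the dispersion relation would hold both with `M` and with
        -- `0`; subtracting gives `v₂ h = 0`, since `lam` and `M` are nonzero.
        have hne : ∀ n, μ θ n ≠ lam := by
          rw [← (hE θ hθ).noEigen_iff h_pos, hf.noEigen_iff h_pos ha₀ hρ₀, mul_zero, sub_zero]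
          intro h0
          have h1 := (hfib θ).1 hmemθ
          have hv₂ : v₂ h = 0 := by
            have h2 : lam * v₂ h * M = 0 := by linarith
            simpa [hlam, hM.ne'] using h2
          refine hexc ⟨hv₂, ?_⟩
          have hW := hf.wronskian h_pos.le ha₀
          rw [hv₂, mul_zero, sub_zero] at hW
          -- With `v₂ h = 0` the Wronskian gives `v₁ h * w₂ h = 1`, so `(v₁ - w₂)² = (v₁ + w₂)² - 4
          -- ≤ 0` at `h`; the two numbers coincide and have square `1`.
          have h3 : (v₁ h - w₂ h) ^ 2 ≤ 0 := by
            have : (v₁ h + w₂ h) ^ 2 ≤ 4 := by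
              rw [h0]; nlinarith [Real.cos_sq_le_one θ]
            nlinarith
          have h4 : v₁ h = w₂ h := by
            have := pow_eq_zero_iff (two_ne_zero) |>.1 (le_antisymm h3 (sq_nonneg _))
            linarith
          rw [← h4] at hW
          rw [← pow_eq_one_iff_of_nonneg (abs_nonneg _) two_ne_zero, sq_abs]
          linarith
        exact ⟨θ, hθ, hne, (hpart θ hθ hne).1 hmemθ⟩
      · rintro ⟨θ, hθ, hne, hs⟩
        exact ⟨θ, hθ, (hpart θ hθ hne).2 hs⟩
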